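/- Let $U\ge 0$, $U\neq 1$, $\mu>0$, and let $\Omega\subset\mathbb{R}^2$ be a bounded open set (for instance a bounded domain with smooth boundary). Let $\mathbb{R}^3_+=\{z>0\}$, let $H_0^2(\Omega)$ be the closure of $C_c^\infty(\Omega)$ in $H^2(\Omega)$, and let $$Y=H^1(\mathbb{R}^3_+)\times L_2(\mathbb{R}^3_+)\times H_0^2(\Omega)\times L_2(\Omega)\ni y=(\phi,\psi;u,v),$$ with the inner product $(y,\tilde y)_Y=(\nabla\phi,\nabla\tilde\phi)+\mu(\phi,\tilde\phi)+(\psi,\tilde\psi)+(\Delta u,\Delta\tilde u)+(v,\tilde v)$. Let $A=-\Delta+\mu$ with Neumann boundary conditions, extended to $H^1(\mathbb{R}^3_+)\to[H^1(\mathbb{R}^3_+)]'$ by $\langle A\phi,w\rangle=(\nabla\phi,\nabla w)+\mu(\phi,w)$. Let $\gamma$ be the trace on $\{z=0\}$. For $f\in L_2(\mathbb{R}^2)$ let $g=Nf\in H^1(\mathbb{R}^3_+)$ be the variational solution of $(-\Delta+\mu)g=0$ in $\mathbb{R}^3_+$, $\partial_\nu g=f$ on $\{z=0\}$ ($\nu$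 the outward normal), so that $\langle ANf,w\rangle=(f,\gamma[w])_{L_2(\mathbb{R}^2)}$. For $v\in L_2(\Omega)$ write $Nv=Nv_{ext}$, with $v_{ext}$ the extension of $v$ by zero. Define $$\mathbb{A}(\phi,\psi;u,v)=\big(-U\partial_x\phi+\psi,\;-U\partial_x\psi-A(\phi+Nv);\;v,\;-\Delta^2u+\gamma[\psi]|_\Omega\big)$$ with domain $\mathscr{D}(\mathbb{A})$ consisting of those $(\phi,\psi;u,v)\in Y$ for which the right-hand side lies in $Y$. Here the second component is understood in $[H^1(\mathbb{R}^3_+)]'$ and the fourth in $[H_0^2(\Omega)]'$, and for $\psi=U\partial_x\phi+k$ with $\phi,k\in H^1(\mathbb{R}^3_+)$ the trace is $\gamma[\psi]=\gamma[k]+U\partial_x\gamma[\phi]\in H^{-1/2}(\mathbb{R}^2)$. Equip $\mathscr{D}(\mathbb{A})$ with the graph norm. Then $\mathbb{A}$ is skew-adjoint in $Y$ and generates a $C_0$-group $e^{\mathbb{A}t}$ on $Y$, and $Y$ is embedded in the dual space $[\mathscr{D}(\mathbb{A})]'$ by $\langle y,h\rangle=(y,h)_Y$. Extend $\mathbb{A}$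 to $Y\to[\mathscr{D}(\mathbb{A})]'$ by $\langle\mathbb{A}y,h\rangle=-(y,\mathbb{A}h)_Y$, and $e^{\mathbb{A}t}$ to $[\mathscr{D}(\mathbb{A})]'$ by $\langle e^{\mathbb{A}t}F,h\rangle=\langle F,e^{-\mathbb{A}t}h\rangle$. Let $\mathbb{P}_\#[u]=(0,-UAN\partial_xu,0,0)$, that is, $\mathbb{P}_\#:H_0^2(\Omega)\to[\mathscr{D}(\mathbb{A})]'$, $$\langle\mathbb{P}_\#[u],(\phi,\psi;u',v')\rangle=-U\langle\partial_xu,\gamma[\psi]\rangle .$$ Let $T>0$, $\overline u\in C^1([0,T];H_0^2(\Omega))$ and $y_0\in Y$. Then for every $t\in[0,T]$ the integral in $$y(t)=e^{\mathbb{A}t}y_0+\int_0^te^{\mathbb{A}(t-s)}\mathbb{P}_\#[\overline u(s)]\,ds$$ exists as an integral in $[\mathscr{D}(\mathbb{A})]'$, $y(t)$ lies in $Y$, and $y\in C([0,T];Y)$. Moreover $y\in C^1((0,T);[\mathscr{D}(\mathbb{A})]')$, $y(0)=y_0$, and $$y_t=\mathbb{A}y+\mathbb{P}_\#[\overline u]\quad\text{in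 }[\mathscr{D}(\mathbb{A})]'\text{ for each }t\in(0,T).$$ -/

import Mathlib

open MeasureTheory Set Filter Topology
open scoped ContDiff RealInnerProductSpace

namespace FlowPlate

noncomputable section

/-! ### The flow domain and the plane containing the plate -/

/-- The plane `{z = 0}`, with coordinates `(x, y)`. -/
abbrev Plane := EuclideanSpace ℝ (Fin 2)

/-- Points `((x, y), z)` of three-dimensional space. Only the Lebesgue measure and directional
derivatives on this space are used. -/
abbrev Space := Plane × ℝ

/-- The open half-space `z > 0` (whose closure is the flow domain). -/
def halfSpace : Set Space := {p | 0 < p.2}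

/-- The coordinate directions of the plane. -/
def planeDir (i : Fin 2) : Plane := EuclideanSpace.single i 1

/-- The coordinate directions of space: `0 ↦ x`, `1 ↦ y`, `2 ↦ z`. -/
def spaceDir : Fin 3 → Space := ![(planeDir 0, 0), (planeDir 1, 0), (0, 1)]

/-- `L²` of the half-space. -/
abbrev L2Half := Lp ℝ 2 ((volume : Measure Space).restrict halfSpace)

/-- `L²` of the plane. -/
abbrev L2Plane := Lp ℝ 2 (volume : Measure Plane)

/-- `L²(Ω)` for a subset `Ω` of the plane. -/
abbrev L2On (Ω : Set Plane) := Lp ℝ 2 ((volume : Measure Plane).restrict Ω)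

/-- `η ∈ C_c^∞(O)`. -/
structure IsTest {E : Type*} [NormedAddCommGroup E] [NormedSpace ℝ E] (O : Set E) (η : E → ℝ) :
    Prop where
  smooth : ContDiff ℝ ∞ η
  compact : HasCompactSupport η
  supp : tsupport η ⊆ O

/-- `g` is the weak derivative of `f` in the direction `e` on the open set `O`. -/
def HasWeakDeriv {E : Type*} [NormedAddCommGroup E] [NormedSpace ℝ E] [MeasureSpace E]
    (O : Set E) (e : E) (f g : E → ℝ) : Prop :=
  ∀ η : E → ℝ, IsTest O η →
    ∫ p in O, f p * fderiv ℝ η p e = -∫ p in O, g p * η p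

/-! ### The space `H¹` of the half-space -/

/-- Pairing with a fixed square integrable function is a continuous functional on `L²`. -/
lemma exists_pairing {α : Type*} [MeasurableSpace α] {m : Measure α} {h : α → ℝ}
    (hh : MemLp h 2 m) : ∃ L : Lp ℝ 2 m →L[ℝ] ℝ, ∀ f, L f = ∫ p, f p * h p ∂m := by
  refine ⟨innerSL ℝ (hh.toLp h), fun f => ?_⟩
  rw [innerSL_apply_apply, L2.inner_def]
  refine integral_congr_ae ?_
  filter_upwards [hh.coeFn_toLp] with p hp
  simp [hp]

lemma IsTest.memLp {E : Type*} [NormedAddCommGroup E] [NormedSpace ℝ E] [MeasurableSpace E]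
    [BorelSpace E] [SecondCountableTopology E] {m : Measure E} [IsFiniteMeasureOnCompacts m]
    {O : Set E} {η : E → ℝ} (h : IsTest O η) : MemLp η 2 m :=
  h.smooth.continuous.memLp_of_hasCompactSupport h.compact

lemma IsTest.memLp_fderiv {E : Type*} [NormedAddCommGroup E] [NormedSpace ℝ E]
    [MeasurableSpace E]
    [BorelSpace E] [SecondCountableTopology E] {m : Measure E} [IsFiniteMeasureOnCompacts m]
    {O : Set E} {η : E → ℝ} (h : IsTest O η) (e : E) :
    MemLp (fun p => fderiv ℝ η p e) 2 m := by
  have hc : Continuous fun p => fderiv ℝ η p e :=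
    (h.smooth.continuous_fderiv (by simp)).clm_apply continuous_const
  exact hc.memLp_of_hasCompactSupport (h.compact.fderiv_apply (𝕜 := ℝ) e)

/-- `L²` functions together with three further `L²` functions (candidates for the gradient). -/
abbrev Jet1 := PiLp 2 (fun _ : Option (Fin 3) => L2Half)

lemma hasWeakDeriv_iff (i : Fin 3) : ∃ K : Set (Jet1 →L[ℝ] ℝ), ∀ p : Jet1,
    HasWeakDeriv halfSpace (spaceDir i) (p none) (p (some i)) ↔ ∀ L ∈ K, L p = 0 := by
  have h1 : ∀ η : Space → ℝ, IsTest halfSpace η → ∃ L : Jet1 →L[ℝ] ℝ, ∀ p : Jet1,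
      L p = (∫ q in halfSpace, p none q * fderiv ℝ η q (spaceDir i))
        + ∫ q in halfSpace, p (some i) q * η q := by
    intro η hη
    obtain ⟨L1, hL1⟩ := exists_pairing
      (hη.memLp_fderiv (m := (volume : Measure Space).restrict halfSpace) (spaceDir i))
    obtain ⟨L2, hL2⟩ := exists_pairing
      (hη.memLp (m := (volume : Measure Space).restrict halfSpace))
    refine ⟨L1 ∘L PiLp.proj 2 (fun _ : Option (Fin 3) => L2Half) none
      + L2 ∘L PiLp.proj 2 (fun _ : Option (Fin 3) => L2Half) (some i), fun p => ?_⟩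
    simp [hL1, hL2]
  choose L hL using h1
  refine ⟨{M | ∃ η, ∃ hη : IsTest halfSpace η, M = L η hη}, fun p => ?_⟩
  constructor
  · rintro h _ ⟨η, hη, rfl⟩
    rw [hL, h η hη, neg_add_cancel]
  · intro h η hη
    have := h _ ⟨η, hη, rfl⟩
    rw [hL] at this
    exact eq_neg_of_add_eq_zero_left this

/-- The Sobolev space `H¹` of the half-space, realized as the space of all tuples
`(φ, ∂_x φ, ∂_y φ, ∂_z φ)` of an `L²` function and its weak derivatives in `L²`. The norm
is the `H¹` norm `(‖φ‖² + ‖∇φ‖²)^(1/2)`. -/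
def sobolevH1 : Submodule ℝ Jet1 where
  carrier := {p | ∀ i, HasWeakDeriv halfSpace (spaceDir i) (p none) (p (some i))}
  zero_mem' := by
    intro i
    obtain ⟨K, hK⟩ := hasWeakDeriv_iff i
    exact (hK 0).2 fun L _ => map_zero L
  add_mem' := by
    intro p q hp hq i
    obtain ⟨K, hK⟩ := hasWeakDeriv_iff i
    refine (hK (p + q)).2 fun L hL => ?_
    rw [map_add, (hK p).1 (hp i) L hL, (hK q).1 (hq i) L hL, add_zero]
  smul_mem' := by
    intro c p hp i
    obtain ⟨K, hK⟩ := hasWeakDeriv_iff i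
    refine (hK (c • p)).2 fun L hL => ?_
    rw [map_smul, (hK p).1 (hp i) L hL, smul_zero]

lemma isClosed_sobolevH1 : IsClosed (sobolevH1 : Set Jet1) := by
  have : (sobolevH1 : Set Jet1)
      = ⋂ i, {p | HasWeakDeriv halfSpace (spaceDir i) (p none) (p (some i))} := by
    ext p; simp [sobolevH1]
  rw [this]
  refine isClosed_iInter fun i => ?_
  obtain ⟨K, hK⟩ := hasWeakDeriv_iff i
  have : {p : Jet1 | HasWeakDeriv halfSpace (spaceDir i) (p none) (p (some i))}
      = ⋂ L ∈ K, {p | L p = 0} := by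
    ext p; simp [hK p]
  rw [this]
  exact isClosed_biInter fun L _ => isClosed_eq L.continuous continuous_const

/-- The Sobolev space `H¹` of the half-space as a type. -/
def H1 : Type := sobolevH1

instance : NormedAddCommGroup H1 := inferInstanceAs (NormedAddCommGroup sobolevH1)
instance : InnerProductSpace ℝ H1 := inferInstanceAs (InnerProductSpace ℝ sobolevH1)
instance : CompleteSpace H1 := isClosed_sobolevH1.completeSpace_coe

/-- The tuple `(φ, ∂_x φ, ∂_y φ, ∂_z φ)`. -/
def H1.jet : H1 →L[ℝ] Jet1 := sobolevH1.subtypeL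

/-- The inclusion of `H¹` into `L²` of the half-space. -/
def H1.val : H1 →L[ℝ] L2Half := PiLp.proj 2 (fun _ : Option (Fin 3) => L2Half) none ∘L H1.jet

/-- The partial derivatives, as maps from `H¹` to `L²` of the half-space. -/
def H1.d (i : Fin 3) : H1 →L[ℝ] L2Half :=
  PiLp.proj 2 (fun _ : Option (Fin 3) => L2Half) (some i) ∘L H1.jet

/-! ### The trace on `z = 0` -/

lemma restrict_halfSpace : (volume : Measure Space).restrict halfSpace
    = (volume : Measure Plane).prod ((volume : Measure ℝ).restrict (Ioi 0)) := by
  have : halfSpace = (univ : Set Plane) ×ˢ Ioi (0 : ℝ) := by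
    ext p; simp [halfSpace]
  rw [this, Measure.volume_eq_prod, ← Measure.prod_restrict, Measure.restrict_univ]

lemma integrable_exp_sq :
    Integrable (fun z : ℝ => Real.exp (-z) ^ 2) (volume.restrict (Ioi 0)) := by
  have h : IntegrableOn (fun z : ℝ => Real.exp ((-2) * z)) (Ioi 0) :=
    integrableOn_exp_mul_Ioi (by norm_num) 0
  refine h.congr (Eventually.of_forall fun z => ?_)
  simp only [← Real.exp_nat_mul]
  congr 1; push_cast; ring

lemma memLp_expExt (g : L2Plane) :
    MemLp (fun p : Space => g p.1 * Real.exp (-p.2)) 2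
      ((volume : Measure Space).restrict halfSpace) := by
  rw [restrict_halfSpace]
  have hm : AEStronglyMeasurable (fun p : Space => g p.1 * Real.exp (-p.2))
      ((volume : Measure Plane).prod ((volume : Measure ℝ).restrict (Ioi 0))) := by
    refine AEStronglyMeasurable.mul ?_ ?_
    · exact (Lp.aestronglyMeasurable g).comp_fst
    · exact (by fun_prop : Continuous fun p : Space => Real.exp (-p.2)).aestronglyMeasurable
  rw [memLp_two_iff_integrable_sq hm]
  have := ((memLp_two_iff_integrable_sq (Lp.aestronglyMeasurable g)).1 (Lp.memLp g)).mul_prod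
    integrable_exp_sq
  refine this.congr (Eventually.of_forall fun p => ?_)
  simp only [mul_pow]

lemma norm_expExt_le (g : L2Plane) : ‖(memLp_expExt g).toLp _‖ ≤ 1 * ‖g‖ := by
  have h1 : ‖(memLp_expExt g).toLp _‖ ^ 2
      = ∫ p, (g p.1 * Real.exp (-p.2)) ^ 2 ∂((volume : Measure Space).restrict halfSpace) := by
    rw [← real_inner_self_eq_norm_sq, L2.inner_def]
    refine integral_congr_ae ?_
    filter_upwards [(memLp_expExt g).coeFn_toLp] with p hp
    rw [hp, real_inner_self_eq_norm_sq, Real.norm_eq_abs, sq_abs]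
  have h2 : ‖g‖ ^ 2 = ∫ x, (g x) ^ 2 := by
    rw [← real_inner_self_eq_norm_sq, L2.inner_def]
    refine integral_congr_ae (Eventually.of_forall fun p => ?_)
    simp [sq]
  have h3 : ∫ z in Ioi (0 : ℝ), Real.exp (-z) ^ 2 = 1 / 2 := by
    have : (fun z : ℝ => Real.exp (-z) ^ 2) = fun z => Real.exp ((-2) * z) := by
      funext z
      simp only [← Real.exp_nat_mul]
      congr 1; push_cast; ring
    rw [this, integral_exp_mul_Ioi (by norm_num)]
    norm_num
  have h4 : ‖(memLp_expExt g).toLp _‖ ^ 2 = ‖g‖ ^ 2 * (1 / 2) := by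
    rw [h1, restrict_halfSpace, h2, ← h3, ← integral_prod_mul]
    simp only [mul_pow]
  rw [one_mul]
  refine le_of_sq_le_sq ?_ (norm_nonneg _)
  nlinarith [sq_nonneg ‖g‖]

/-- The map `g ↦ ((x, y, z) ↦ e^{-z} g(x, y))` from `L²` of the plane to `L²` of the half-space. -/
def expExt : L2Plane →L[ℝ] L2Half :=
  LinearMap.mkContinuous
    { toFun := fun g => (memLp_expExt g).toLp _
      map_add' := by
        intro f g
        rw [← MemLp.toLp_add]
        refine (MemLp.toLp_eq_toLp_iff _ _).2 ?_
        rw [restrict_halfSpace]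
        filter_upwards [Measure.quasiMeasurePreserving_fst.ae (Lp.coeFn_add f g)] with p hp
        simp only [Pi.add_apply] at hp ⊢
        rw [hp]; ring
      map_smul' := by
        intro c g
        rw [RingHom.id_apply, ← MemLp.toLp_const_smul]
        refine (MemLp.toLp_eq_toLp_iff _ _).2 ?_
        rw [restrict_halfSpace]
        filter_upwards [Measure.quasiMeasurePreserving_fst.ae (Lp.coeFn_smul c g)] with p hp
        simp only [Pi.smul_apply, smul_eq_mul] at hp ⊢
        rw [hp]; ring }
    1 norm_expExt_le

/-- The trace `γ : H¹ → L²(ℝ²)` on the plane `z = 0`, given by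
`γ[φ](x, y) = ∫_0^∞ e^{-z} (φ - ∂_z φ)(x, y, z) dz = - ∫_0^∞ ∂_z (e^{-z} φ)(x, y, z) dz`.
It is continuous on `H¹`, and `trace_eq_restriction` below says that it is restriction to `z = 0`
on the functions that are continuously differentiable up to the boundary with compact support,
which are dense in `H¹`. -/
def trace : H1 →L[ℝ] L2Plane :=
  ContinuousLinearMap.adjoint expExt ∘L (H1.val - H1.d 2)

/-- The trace is restriction to `z = 0` on functions that are smooth up to the boundary. -/
lemma trace_eq_restriction {f : Space → ℝ} (hf : ContDiff ℝ 1 f) (hc : HasCompactSupport f)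
    (φ : H1) (h0 : H1.val φ =ᵐ[(volume : Measure Space).restrict halfSpace] f)
    (h2 : H1.d 2 φ =ᵐ[(volume : Measure Space).restrict halfSpace]
      fun p => fderiv ℝ f p (spaceDir 2)) :
    trace φ =ᵐ[volume] fun x => f (x, 0) := by
  have hdir : spaceDir 2 = ((0 : Plane), (1 : ℝ)) := rfl
  have hcd : Continuous fun p => fderiv ℝ f p (spaceDir 2) :=
    (hf.continuous_fderiv one_ne_zero).clm_apply continuous_const
  have hccd : HasCompactSupport fun p => fderiv ℝ f p (spaceDir 2) :=
    hc.fderiv_apply (𝕜 := ℝ) _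
  have hemb : Topology.IsClosedEmbedding fun x : Plane => (x, (0 : ℝ)) :=
    Topology.IsClosedEmbedding.of_continuous_injective_isClosedMap (by fun_prop)
      (fun a b h => congrArg Prod.fst h)
      (fun s hs => by
        have : (fun x : Plane => (x, (0 : ℝ))) '' s = s ×ˢ {0} := by
          ext p; constructor
          · rintro ⟨x, hx, rfl⟩; exact ⟨hx, rfl⟩
          · rintro ⟨hx, hz⟩; exact ⟨p.1, hx, Prod.ext rfl (Eq.symm hz)⟩
        rw [this]; exact hs.prod isClosed_singleton)
  have hf0c : Continuous fun x : Plane => f (x, 0) := hf.continuous.comp (by fun_prop)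
  have hf0s : HasCompactSupport fun x : Plane => f (x, 0) := hc.comp_isClosedEmbedding hemb
  have hf0 : MemLp (fun x : Plane => f (x, 0)) 2 volume := hf0c.memLp_of_hasCompactSupport hf0s
  suffices h : trace φ = hf0.toLp _ by rw [h]; exact hf0.coeFn_toLp
  refine ext_inner_left ℝ fun g => ?_
  have hin : ∀ x : Plane,
      ∫ z in Ioi (0 : ℝ), Real.exp (-z) * (f (x, z) - fderiv ℝ f (x, z) (spaceDir 2))
        = f (x, 0) := by
    intro x
    have hd : ∀ z : ℝ, HasDerivAt (fun z => -(Real.exp (-z) * f (x, z)))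
        (Real.exp (-z) * (f (x, z) - fderiv ℝ f (x, z) (spaceDir 2))) z := by
      intro z
      have e1 : HasDerivAt (fun z : ℝ => f (x, z)) (fderiv ℝ f (x, z) (spaceDir 2)) z := by
        have := (hf.differentiable one_ne_zero (x, z)).hasFDerivAt.comp_hasDerivAt z
          ((hasDerivAt_const z x).prodMk (hasDerivAt_id z))
        exact this
      have e2 : HasDerivAt (fun z : ℝ => Real.exp (-z)) (Real.exp (-z) * (-1)) z :=
        (hasDerivAt_neg z).exp
      exact (e2.mul e1).neg.congr_deriv (by ring)
    have hembx : Topology.IsClosedEmbedding fun z : ℝ => (x, z) :=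
      Topology.IsClosedEmbedding.of_continuous_injective_isClosedMap (by fun_prop)
        (fun a b h => congrArg Prod.snd h)
        (fun s hs => by
          have : (fun z : ℝ => (x, z)) '' s = {x} ×ˢ s := by
            ext p; constructor
            · rintro ⟨z, hz, rfl⟩; exact ⟨rfl, hz⟩
            · rintro ⟨hx, hz⟩; exact ⟨p.2, hz, Prod.ext (Eq.symm hx) rfl⟩
          rw [this]; exact isClosed_singleton.prod hs)
    have hs1 : HasCompactSupport fun z : ℝ => f (x, z) := hc.comp_isClosedEmbedding hembx
    have hs2 : HasCompactSupport fun z : ℝ => fderiv ℝ f (x, z) (spaceDir 2) :=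
      hccd.comp_isClosedEmbedding hembx
    have hint : Integrable fun z : ℝ =>
        Real.exp (-z) * (f (x, z) - fderiv ℝ f (x, z) (spaceDir 2)) := by
      refine Continuous.integrable_of_hasCompactSupport ?_ ?_
      · have c1 : Continuous fun z : ℝ => f (x, z) := hf.continuous.comp (by fun_prop)
        have c2 : Continuous fun z : ℝ => fderiv ℝ f (x, z) (spaceDir 2) :=
          hcd.comp (by fun_prop)
        fun_prop
      · exact (hs1.sub hs2).mul_left
    have hlim : Tendsto (fun z => -(Real.exp (-z) * f (x, z))) atTop (𝓝 0) := by
      have : (fun z : ℝ => -(Real.exp (-z) * f (x, z))) =ᶠ[atTop] fun _ => 0 := by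
        obtain ⟨R, hR⟩ := hs1.isCompact.bddAbove
        filter_upwards [eventually_gt_atTop R] with z hz
        have : f (x, z) = 0 := by
          by_contra hne
          exact absurd (hR (subset_tsupport (fun z : ℝ => f (x, z)) hne)) (not_le.2 hz)
        simp [this]
      exact tendsto_const_nhds.congr' this.symm
    have := integral_Ioi_of_hasDerivAt_of_tendsto' (a := 0) (fun z _ => hd z)
      hint.integrableOn hlim
    rw [this]; simp
  have hE : ⟪g, trace φ⟫ = ∫ p, (g p.1 * Real.exp (-p.2)) *
      (f p - fderiv ℝ f p (spaceDir 2)) ∂((volume : Measure Space).restrict halfSpace) := by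
    rw [trace, ContinuousLinearMap.comp_apply, ContinuousLinearMap.adjoint_inner_right,
      L2.inner_def]
    refine integral_congr_ae ?_
    filter_upwards [(memLp_expExt g).coeFn_toLp, h0, h2,
      Lp.coeFn_sub (H1.val φ) (H1.d 2 φ)] with p hp hp0 hp2 hps
    have e1 : (expExt g) p = g p.1 * Real.exp (-p.2) := hp
    have e2 : ((H1.val - H1.d 2) φ) p = f p - fderiv ℝ f p (spaceDir 2) := by
      rw [_root_.sub_apply, hps, Pi.sub_apply, hp0, hp2]
    rw [e1, e2]
    simp [mul_comm]
  have hI : Integrable (fun p : Space => (g p.1 * Real.exp (-p.2)) *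
      (f p - fderiv ℝ f p (spaceDir 2)))
      ((volume : Measure Plane).prod ((volume : Measure ℝ).restrict (Ioi 0))) := by
    rw [← restrict_halfSpace]
    exact (memLp_expExt g).integrable_mul (q := 2)
      ((hf.continuous.sub hcd).memLp_of_hasCompactSupport (hc.sub hccd))
  rw [hE, restrict_halfSpace, integral_prod _ hI, L2.inner_def]
  refine integral_congr_ae ?_
  filter_upwards [hf0.coeFn_toLp] with x hx
  rw [hx]
  simp only [mul_assoc]
  rw [integral_const_mul, hin x]
  simp [mul_comm]

/-! ### Neumann map -/

/-- The inner product of a real inner product space as a continuous bilinear form. -/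
def ip (E : Type*) [NormedAddCommGroup E] [InnerProductSpace ℝ E] : E →L[ℝ] E →L[ℝ] ℝ :=
  LinearMap.mkContinuous₂ (innerₗ E) 1 fun x y => by
    simpa using norm_inner_le_norm (𝕜 := ℝ) x y

@[simp] lemma ip_apply {E : Type*} [NormedAddCommGroup E] [InnerProductSpace ℝ E] (x y : E) :
    ip E x y = ⟪x, y⟫ := rfl

/-- The operator `A = -Δ + μ` with Neumann boundary conditions, extended to `H¹ → (H¹)'`:
`⟨A φ, w⟩ = (∇φ, ∇w) + μ (φ, w) = (A^{1/2} φ, A^{1/2} w)`. -/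
def opA (μ : ℝ) : H1 →L[ℝ] H1 →L[ℝ] ℝ :=
  μ • (ip L2Half).bilinearComp H1.val H1.val
    + ∑ i : Fin 3, (ip L2Half).bilinearComp (H1.d i) (H1.d i)

lemma opA_apply (μ : ℝ) (φ w : H1) :
    opA μ φ w = μ * ⟪H1.val φ, H1.val w⟫ + ∑ i : Fin 3, ⟪H1.d i φ, H1.d i w⟫ := by
  simp [opA]

lemma norm_sq_H1 (φ : H1) : ‖φ‖ ^ 2 = ‖H1.val φ‖ ^ 2 + ∑ i : Fin 3, ‖H1.d i φ‖ ^ 2 := by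
  change ‖H1.jet φ‖ ^ 2 = _
  rw [PiLp.norm_sq_eq_of_L2, Fintype.sum_option]
  congr 1

lemma isCoercive_opA {μ : ℝ} (hμ : 0 < μ) : IsCoercive (opA μ) := by
  refine ⟨min μ 1, lt_min hμ one_pos, fun φ => ?_⟩
  have h0 := norm_sq_H1 φ
  have h4 := opA_apply μ φ φ
  simp only [real_inner_self_eq_norm_sq] at h4
  have h1 : 0 ≤ ∑ i : Fin 3, ‖H1.d i φ‖ ^ 2 := Finset.sum_nonneg fun i _ => sq_nonneg _
  have h2 := mul_le_mul_of_nonneg_right (min_le_left μ 1) (sq_nonneg ‖H1.val φ‖)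
  have h3 := mul_le_mul_of_nonneg_right (min_le_right μ 1) h1
  rw [h4, mul_assoc, ← sq, h0]
  linarith

/-- The Neumann map `N`: `g = N f ∈ H¹` is the variational solution of `(-Δ + μ) g = 0` in the
half-space with `∂_ν g = f` on `z = 0`, where `ν` is the outward normal. -/
def neumannMap {μ : ℝ} (hμ : 0 < μ) : L2Plane →L[ℝ] H1 :=
  ((isCoercive_opA hμ).continuousLinearEquivOfBilin.symm : H1 →L[ℝ] H1) ∘L
    ContinuousLinearMap.adjoint trace

/-- The variational problem solved by `N f`. -/
lemma opA_neumannMap {μ : ℝ} (hμ : 0 < μ) (f : L2Plane) (w : H1) :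
    opA μ (neumannMap hμ f) w = ⟪f, trace w⟫ := by
  rw [← (isCoercive_opA hμ).continuousLinearEquivOfBilin_apply]
  simp [neumannMap, ContinuousLinearMap.adjoint_inner_left]

/-! ### The plate -/

/-- Tuples `(u, (∂_i u)_i, (∂_i ∂_j u)_{i,j})` of `L²(Ω)` functions, with the `H²` norm. -/
abbrev Jet2 (Ω : Set Plane) := PiLp 2 (fun _ : Option (Fin 2 ⊕ Fin 2 × Fin 2) => L2On Ω)

/-- `p` consists of a function in `C_c^∞(Ω)` and its partial derivatives up to order two. -/
def IsTestJet (Ω : Set Plane) (p : Jet2 Ω) : Prop :=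
  ∃ η : Plane → ℝ, IsTest Ω η ∧
    p none =ᵐ[volume.restrict Ω] η ∧
    (∀ i, p (some (.inl i)) =ᵐ[volume.restrict Ω] fun x => fderiv ℝ η x (planeDir i)) ∧
    ∀ i j, p (some (.inr (i, j))) =ᵐ[volume.restrict Ω]
      fun x => fderiv ℝ (fun x' => fderiv ℝ η x' (planeDir j)) x (planeDir i)

/-- `H²₀(Ω)`: the closure of `C_c^∞(Ω)` in the `H²(Ω)` norm. -/
def sobolevH02 (Ω : Set Plane) : Submodule ℝ (Jet2 Ω) :=
  (Submodule.span ℝ {p | IsTestJet Ω p}).topologicalClosure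

variable (Ω : Set Plane)

/-- `H²₀(Ω)` as a type. -/
def H02 : Type := sobolevH02 Ω

instance : NormedAddCommGroup (H02 Ω) := inferInstanceAs (NormedAddCommGroup (sobolevH02 Ω))
instance : InnerProductSpace ℝ (H02 Ω) := inferInstanceAs (InnerProductSpace ℝ (sobolevH02 Ω))

/-- The tuple `(u, (∂_i u)_i, (∂_i ∂_j u)_{i,j})`. -/
def H02.jet : H02 Ω →L[ℝ] Jet2 Ω := (sobolevH02 Ω).subtypeL

/-- The inclusion of `H²₀(Ω)` into `L²(Ω)`. -/
def H02.val : H02 Ω →L[ℝ] L2On Ω :=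
  PiLp.proj 2 (fun _ : Option (Fin 2 ⊕ Fin 2 × Fin 2) => L2On Ω) none ∘L H02.jet Ω

/-- `u ↦ ∂_i u`. -/
def H02.d (i : Fin 2) : H02 Ω →L[ℝ] L2On Ω :=
  PiLp.proj 2 (fun _ : Option (Fin 2 ⊕ Fin 2 × Fin 2) => L2On Ω) (some (.inl i)) ∘L H02.jet Ω

/-- `u ↦ ∂_i ∂_j u`. -/
def H02.dd (i j : Fin 2) : H02 Ω →L[ℝ] L2On Ω :=
  PiLp.proj 2 (fun _ : Option (Fin 2 ⊕ Fin 2 × Fin 2) => L2On Ω) (some (.inr (i, j))) ∘L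
    H02.jet Ω

/-- The Laplacian `H²₀(Ω) → L²(Ω)`. -/
def H02.lap : H02 Ω →L[ℝ] L2On Ω := H02.dd Ω 0 0 + H02.dd Ω 1 1

/-- Restriction of functions on the plane to `Ω`. -/
def restr : L2Plane →L[ℝ] L2On Ω := LpToLpRestrictCLM Plane ℝ ℝ volume 2 Ω

/-- Extension by zero `v ↦ v_ext` from `Ω` to the plane. -/
def zeroExt : L2On Ω →L[ℝ] L2Plane := ContinuousLinearMap.adjoint (restr Ω)

/-! ### The state space and the operator `𝔸` -/

/-- The state space `Y = H¹ × L² × H²₀(Ω) × L²(Ω)` of quadruples `(φ, ψ; u, v)`. The norm of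
the product is equivalent to the Hilbert norms used on `Y`; the inner product of `Y` is
`energyInner` below. -/
def Y : Type := H1 × L2Half × H02 Ω × L2On Ω

instance : NormedAddCommGroup (Y Ω) :=
  inferInstanceAs (NormedAddCommGroup (H1 × L2Half × H02 Ω × L2On Ω))
instance : NormedSpace ℝ (Y Ω) :=
  inferInstanceAs (NormedSpace ℝ (H1 × L2Half × H02 Ω × L2On Ω))

/-- The space `Y` is the product of its four components. -/
def Y.equiv : Y Ω ≃L[ℝ] H1 × L2Half × H02 Ω × L2On Ω := .refl ℝ _

variable {Ω}

/-- The component `φ` of a state. -/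
def Y.phi : Y Ω →L[ℝ] H1 := .fst ℝ H1 (L2Half × H02 Ω × L2On Ω) ∘L (Y.equiv Ω : _ →L[ℝ] _)

/-- The component `ψ` of a state. -/
def Y.psi : Y Ω →L[ℝ] L2Half :=
  .fst ℝ L2Half (H02 Ω × L2On Ω) ∘L .snd ℝ H1 (L2Half × H02 Ω × L2On Ω) ∘L
    (Y.equiv Ω : _ →L[ℝ] _)

/-- The component `u` of a state. -/
def Y.u : Y Ω →L[ℝ] H02 Ω :=
  .fst ℝ (H02 Ω) (L2On Ω) ∘L .snd ℝ L2Half (H02 Ω × L2On Ω) ∘L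
    .snd ℝ H1 (L2Half × H02 Ω × L2On Ω) ∘L (Y.equiv Ω : _ →L[ℝ] _)

/-- The component `v` of a state. -/
def Y.v : Y Ω →L[ℝ] L2On Ω :=
  .snd ℝ (H02 Ω) (L2On Ω) ∘L .snd ℝ L2Half (H02 Ω × L2On Ω) ∘L
    .snd ℝ H1 (L2Half × H02 Ω × L2On Ω) ∘L (Y.equiv Ω : _ →L[ℝ] _)

variable (Ω)

/-- The inner product of `Y = D(A^{1/2}) × L² × D(𝒜^{1/2}) × L²(Ω)`,
`(A^{1/2} φ, A^{1/2} φ̃) + (ψ, ψ̃) + (Δu, Δũ) + (v, ṽ)`. -/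
def energyInner (μ : ℝ) : Y Ω →L[ℝ] Y Ω →L[ℝ] ℝ :=
  (opA μ).bilinearComp Y.phi Y.phi + (ip L2Half).bilinearComp Y.psi Y.psi
    + (ip (L2On Ω)).bilinearComp (H02.lap Ω ∘L Y.u) (H02.lap Ω ∘L Y.u)
    + (ip (L2On Ω)).bilinearComp Y.v Y.v

lemma energyInner_apply (μ : ℝ) (y z : Y Ω) :
    energyInner Ω μ y z = opA μ (Y.phi y) (Y.phi z) + ⟪Y.psi y, Y.psi z⟫
      + ⟪H02.lap Ω (Y.u y), H02.lap Ω (Y.u z)⟫ + ⟪Y.v y, Y.v z⟫ := rfl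

/-- The trace of `ψ = U ∂_x φ + k` on `Ω`, for `φ, k ∈ H¹`: it is the distribution
`γ[ψ] = γ[k] + U ∂_x γ[φ]` in `H^{-1/2}(Ω)`. It acts on a function `w` that vanishes on `∂Ω` by
`⟨γ[ψ], w⟩ = (γ[k], w)_Ω - U (γ[φ], ∂_x w)_Ω`. The arguments are `(φ, k)` and `(w, ∂_x w)`. -/
def psiTrace (U : ℝ) : H1 × H1 →L[ℝ] L2On Ω × L2On Ω →L[ℝ] ℝ :=
  (ip (L2On Ω)).bilinearComp (restr Ω ∘L trace ∘L .snd ℝ _ _) (.fst ℝ _ _)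
    - U • (ip (L2On Ω)).bilinearComp (restr Ω ∘L trace ∘L .fst ℝ _ _) (.snd ℝ _ _)

lemma psiTrace_apply (U : ℝ) (p : H1 × H1) (q : L2On Ω × L2On Ω) :
    psiTrace Ω U p q = ⟪restr Ω (trace p.2), q.1⟫ - U * ⟪restr Ω (trace p.1), q.2⟫ := rfl

/-- The operator
`𝔸 (φ, ψ; u, v) = (-U ∂_x φ + ψ, -U ∂_x ψ - A (φ + N v_ext); v, -𝒜 u + N^* A ψ)`. Its domain
consists of those `y ∈ Y` for which the right-hand side lies in `Y`; for `y = (φ, ψ; u, v)` and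
`z ∈ Y`, the statement `y ∈ D(𝔸)`, `𝔸 y = z` means that
* the first component of `z` is `-U ∂_x φ + ψ ∈ H¹`;
* the second is `-U ∂_x ψ - A (φ + N v_ext) ∈ L²`, as an equality of functionals on `H¹`;
* the third is `v ∈ H²₀(Ω)`;
* the fourth is `-𝒜 u + γ[ψ] ∈ L²(Ω)` with `𝒜 = Δ²` and `N^* A ψ = γ[ψ]`, as an equality of
  functionals on `H²₀(Ω)`. -/
structure IsValue (U : ℝ) {μ : ℝ} (hμ : 0 < μ) (y z : Y Ω) : Prop where
  phi_eq : H1.val (Y.phi z) = -U • H1.d 0 (Y.phi y) + Y.psi y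
  psi_eq : ∀ w : H1, ⟪Y.psi z, H1.val w⟫ = U * ⟪Y.psi y, H1.d 0 w⟫
    - opA μ (Y.phi y + neumannMap hμ (zeroExt Ω (Y.v y))) w
  u_eq : H02.val Ω (Y.u z) = Y.v y
  v_eq : ∀ w : H02 Ω, ⟪Y.v z, H02.val Ω w⟫ = -⟪H02.lap Ω (Y.u y), H02.lap Ω w⟫
    + psiTrace Ω U (Y.phi y, Y.phi z) (H02.val Ω w, H02.d Ω 0 w)

/-- The graph of the operator `𝔸`. -/
def bbA (U : ℝ) {μ : ℝ} (hμ : 0 < μ) : Submodule ℝ (Y Ω × Y Ω) where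
  carrier := {p | IsValue Ω U hμ p.1 p.2}
  zero_mem' := by
    refine ⟨?_, fun w => ?_, ?_, fun w => ?_⟩ <;>
      simp only [psiTrace_apply, Prod.fst_zero, Prod.snd_zero, map_zero, smul_zero, mul_zero,
        add_zero, sub_zero, inner_zero_left, zero_apply, neg_zero]
  add_mem' := by
    rintro ⟨y, z⟩ ⟨y', z'⟩ ⟨p1, p2, p3, p4⟩ ⟨q1, q2, q3, q4⟩
    simp only at p1 p2 p3 p4 q1 q2 q3 q4
    refine ⟨?_, fun w => ?_, ?_, fun w => ?_⟩
    · simp only [Prod.mk_add_mk, map_add, p1, q1, smul_add]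
      module
    · have a := p2 w
      have b := q2 w
      simp only [Prod.mk_add_mk, map_add, _root_.add_apply, inner_add_left] at a b ⊢
      linear_combination a + b
    · simp only [Prod.mk_add_mk, map_add, p3, q3]
    · have a := p4 w
      have b := q4 w
      simp only [Prod.mk_add_mk, psiTrace_apply, map_add, inner_add_left] at a b ⊢
      linear_combination a + b
  smul_mem' := by
    rintro c ⟨y, z⟩ ⟨p1, p2, p3, p4⟩
    simp only at p1 p2 p3 p4
    refine ⟨?_, fun w => ?_, ?_, fun w => ?_⟩
    · simp only [Prod.smul_mk, map_smul, p1, smul_add]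
      module
    · have a := p2 w
      simp only [Prod.smul_mk, map_add, map_smul, _root_.add_apply, _root_.smul_apply,
        smul_eq_mul, real_inner_smul_left] at a ⊢
      linear_combination c * a
    · simp only [Prod.smul_mk, map_smul, p3]
    · have a := p4 w
      simp only [Prod.smul_mk, psiTrace_apply, map_smul, real_inner_smul_left] at a ⊢
      linear_combination c * a

/-- `𝔸^* = -𝔸` in `Y`: a pair `(y, z)` satisfies `(y, 𝔸 h)_Y = (-z, h)_Y` for all `h ∈ D(𝔸)` if and
only if `y ∈ D(𝔸)` and `𝔸 y = z`. -/
def IsSkewAdjoint (U : ℝ) {μ : ℝ} (hμ : 0 < μ) : Prop :=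
  ∀ y z : Y Ω, (y, z) ∈ bbA Ω U hμ ↔
    ∀ h ∈ bbA Ω U hμ, energyInner Ω μ y h.2 = energyInner Ω μ (-z) h.1

/-! ### Strongly continuous groups -/

/-- A strongly continuous group of bounded operators. -/
structure C0Group (X : Type*) [NormedAddCommGroup X] [NormedSpace ℝ X] where
  op : ℝ → X →L[ℝ] X
  op_zero : op 0 = ContinuousLinearMap.id ℝ X
  op_add : ∀ s t, op (s + t) = op s ∘L op t
  continuous_op : ∀ x, Continuous fun t => op t x

/-- The operator with graph `B` is the infinitesimal generator of the group `S`. -/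
def C0Group.HasGenerator {X : Type*} [NormedAddCommGroup X] [NormedSpace ℝ X] (S : C0Group X)
    (B : Submodule ℝ (X × X)) : Prop :=
  ∀ x x', (x, x') ∈ B ↔ HasDerivAt (fun t => S.op t x) x' 0

lemma C0Group.HasGenerator.map_mem {X : Type*} [NormedAddCommGroup X] [NormedSpace ℝ X]
    {S : C0Group X} {B : Submodule ℝ (X × X)} (hS : S.HasGenerator B) (t : ℝ) :
    ∀ h ∈ B, ((S.op t).prodMap (S.op t)) h ∈ B := by
  rintro ⟨x, x'⟩ h
  refine (hS _ _).2 ?_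
  have h1 := (S.op t).hasFDerivAt.comp_hasDerivAt (0 : ℝ) ((hS _ _).1 h)
  refine h1.congr_of_eventuallyEq (Eventually.of_forall fun s => ?_)
  change S.op s (S.op t x) = S.op t (S.op s x)
  rw [← ContinuousLinearMap.comp_apply, ← ContinuousLinearMap.comp_apply, ← S.op_add,
    ← S.op_add, add_comm]

/-- The restriction of a group to the domain of its generator with the graph norm. -/
def C0Group.HasGenerator.onDomain {X : Type*} [NormedAddCommGroup X] [NormedSpace ℝ X]
    {S : C0Group X} {B : Submodule ℝ (X × X)} (hS : S.HasGenerator B) (t : ℝ) : B →L[ℝ] B :=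
  (((S.op t).prodMap (S.op t)) ∘L B.subtypeL).codRestrict B fun h => hS.map_mem t h h.2

/-! ### The extended space `[D(𝔸)]'` -/

/-- The space `D(𝔸)` with the graph norm, identified with the graph of `𝔸` (with its norm as a
subspace of `Y × Y`). -/
def DomA (U : ℝ) {μ : ℝ} (hμ : 0 < μ) : Type := bbA Ω U hμ

section

variable (U : ℝ) {μ : ℝ} (hμ : 0 < μ)

instance : NormedAddCommGroup (DomA Ω U hμ) := inferInstanceAs (NormedAddCommGroup (bbA Ω U hμ))
instance : NormedSpace ℝ (DomA Ω U hμ) := inferInstanceAs (NormedSpace ℝ (bbA Ω U hμ))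

/-- The inclusion `D(𝔸) → Y`. -/
def DomA.val : DomA Ω U hμ →L[ℝ] Y Ω := .fst ℝ (Y Ω) (Y Ω) ∘L (bbA Ω U hμ).subtypeL

/-- The bounded map `h ↦ 𝔸 h` from `D(𝔸)` to `Y`. -/
def DomA.app : DomA Ω U hμ →L[ℝ] Y Ω := .snd ℝ (Y Ω) (Y Ω) ∘L (bbA Ω U hμ).subtypeL

/-- `[D(𝔸)]'`, the dual of `D(𝔸)` with the graph norm. -/
abbrev DualD := DomA Ω U hμ →L[ℝ] ℝ

/-- The embedding `Y → [D(𝔸)]'` with `Y` as pivot space: `⟨y, h⟩ = (y, h)_Y`. -/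
def embed : Y Ω →L[ℝ] DualD Ω U hμ :=
  (energyInner Ω μ).bilinearComp (.id ℝ (Y Ω)) (DomA.val Ω U hμ)

lemma embed_apply (y : Y Ω) (h : DomA Ω U hμ) :
    embed Ω U hμ y h = energyInner Ω μ y (DomA.val Ω U hμ h) := rfl

/-- The extension of `𝔸` to an operator `Y → [D(𝔸)]'`:
`⟨𝔸 y, h⟩ = (y, 𝔸^* h)_Y = -(y, 𝔸 h)_Y`. -/
def extA : Y Ω →L[ℝ] DualD Ω U hμ :=
  -(energyInner Ω μ).bilinearComp (.id ℝ (Y Ω)) (DomA.app Ω U hμ)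

lemma extA_apply (y : Y Ω) (h : DomA Ω U hμ) :
    extA Ω U hμ y h = -energyInner Ω μ y (DomA.app Ω U hμ h) := rfl

/-- The map `ℙ_# [u] = (0, -U A N ∂_x u, 0, 0)` from `H²₀(Ω)` to `[D(𝔸)]'`, where `∂_x u` is
extended by zero. By `N^* A = γ`, it acts on `h = (φ, ψ; u', v') ∈ D(𝔸)` by
`⟨ℙ_# [u], h⟩ = -U ⟨∂_x u, γ[ψ]⟩`, where `ψ = U ∂_x φ + k` and `k` is the first component of
`𝔸 h`. -/
def Psharp : H02 Ω →L[ℝ] DualD Ω U hμ :=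
  -U • (psiTrace Ω U).flip.bilinearComp ((H02.d Ω 0).prod (H02.dd Ω 0 0))
    ((Y.phi ∘L DomA.val Ω U hμ).prod (Y.phi ∘L DomA.app Ω U hμ))

lemma Psharp_apply (u : H02 Ω) (h : DomA Ω U hμ) :
    Psharp Ω U hμ u h = -U * psiTrace Ω U
      (Y.phi (DomA.val Ω U hμ h), Y.phi (DomA.app Ω U hμ h)) (H02.d Ω 0 u, H02.dd Ω 0 0 u) := rfl

end

variable {Ω}

/-- The extension of the group `e^{𝔸 t}` to `[D(𝔸)]'`, that is, the adjoint of the restriction of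
`(e^{𝔸 t})^* = e^{-𝔸 t}` to `D(𝔸)`. -/
def extGroup {U : ℝ} {μ : ℝ} {hμ : 0 < μ} {S : C0Group (Y Ω)}
    (hS : S.HasGenerator (bbA Ω U hμ)) (t : ℝ) (F : DualD Ω U hμ) : DualD Ω U hμ :=
  F ∘L (hS.onDomain (-t) : DomA Ω U hμ →L[ℝ] DomA Ω U hμ)

lemma extGroup_apply {U : ℝ} {μ : ℝ} {hμ : 0 < μ} {S : C0Group (Y Ω)}
    (hS : S.HasGenerator (bbA Ω U hμ)) (t : ℝ) (F : DualD Ω U hμ) (h : DomA Ω U hμ) :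
    ∃ h' : DomA Ω U hμ, DomA.val Ω U hμ h' = S.op (-t) (DomA.val Ω U hμ h) ∧
      extGroup hS t F h = F h' :=
  ⟨_, rfl, rfl⟩

end

end FlowPlate

open FlowPlate

/-!
The operator `𝔸` is skew-adjoint, so it generates a group by Stone's theorem, and the inhomogeneity
`ℙ_# [u]`, although it only lies in the extended space `[D(𝔸)]'`, is of the form `𝔸 w + r` with
`w, r ∈ Y` depending boundedly on `u ∈ H²₀(Ω)`. Integration by parts in time then removes the
unbounded operator from the variation of parameters formula.

* *Skew-symmetry* (`IsValue.energyInner_eq_zero`). The formal energy identity tests the second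
  equation with `ψ = U ∂_x φ + k`, which is not in `H¹`. Since the equation on the half-space is
  invariant under translations in `x`, it can be tested with `φ(· + t) - φ(· - t)` instead, and the
  derivative at `t = 0` gives the missing pairing `(𝔸 y)₂ · ∂_x φ` (`IsValue.inner_psi_d`). The
  boundary term is harmless because `v` is in `H²₀(Ω)` on the domain, so that its extension by zero
  has a weak derivative on the whole plane (`H02.hasDerivAt_transl`). Throughout, the weak
  derivative in `L²` is identified with the generator of translations
  (`ShiftInvariant.hasDerivAt_transl`).
* *Maximality* (`skewAdjointGraph_bbA`). Testing `(y, 𝔸 h)_Y = -(z, h)_Y` with the domain elements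
  `(0, ψ'; 0, 0)`, `(A⁻¹ g, 0; 0, 0)`, `(0, 0; (Δ²)⁻¹ g, 0)` and `(-N v', 0; 0, v')`, where
  `ψ', g ∈ H¹` in the first two, `g ∈ L²(Ω)` in the third and `v' ∈ H²₀(Ω)`, recovers the four
  equations that define `𝔸 y = z`.
* *Generation* (`SkewAdjointGraph.exists_group_of_coercive`). The bilinear form of `Y` is coercive
  because `‖Δ u‖` controls the `H²` norm on a bounded `Ω` (`H02.exists_norm_sq_le`). Stone's theorem
  is proved with symmetrized Yosida approximations, which are bounded, skew-adjoint and commute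
  with each other.
* *The inhomogeneous equation* (`Psharp_eq`, `exists_mild_solution`). One has
  `ℙ_# [u] = 𝔸 (U N ∂_x u, 0; 0, 0) + (U² N ∂_x² u, 0; 0, 0)`, because
  `∂_x N ∂_x u = N ∂_x² u` for `u ∈ H²₀(Ω)`.
-/

namespace FlowPlate

/-! ### Skew-adjoint operators in a Hilbert space and the groups they generate -/

/-- The operator `A` with graph `B` is skew-adjoint with respect to the bilinear form `e`: a pair
`(x, z)` belongs to the graph if and only if `e(x, A h) = -e(z, h)` for all `h` in the domain.
Operators are given by their graphs, which are not required to be single-valued. -/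
def SkewAdjointGraph {X : Type*} [NormedAddCommGroup X] [NormedSpace ℝ X]
    (e : X →L[ℝ] X →L[ℝ] ℝ) (B : Submodule ℝ (X × X)) : Prop :=
  ∀ x z : X, (x, z) ∈ B ↔ ∀ h ∈ B, e x h.2 = e (-z) h.1

namespace SkewAdjointGraph

section Hilbert

variable {X : Type*} [NormedAddCommGroup X] [InnerProductSpace ℝ X]
  {B : Submodule ℝ (X × X)}

lemma inner_eq (hB : SkewAdjointGraph (ip X) B) {x z y w : X} (hx : (x, z) ∈ B)
    (hy : (y, w) ∈ B) : ⟪x, w⟫ = -⟪z, y⟫ := by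
  simpa using (hB x z).1 hx (y, w) hy

lemma inner_self_eq_zero (hB : SkewAdjointGraph (ip X) B) {x z : X} (hx : (x, z) ∈ B) :
    ⟪x, z⟫ = 0 := by
  have := hB.inner_eq hx hx
  rw [real_inner_comm] at this
  rw [real_inner_comm]
  linarith

lemma norm_sq_smul_sub (hB : SkewAdjointGraph (ip X) B) {x z : X} (hx : (x, z) ∈ B) (a : ℝ) :
    ‖a • x - z‖ ^ 2 = a ^ 2 * ‖x‖ ^ 2 + ‖z‖ ^ 2 := by
  rw [norm_sub_sq_real, real_inner_smul_left, hB.inner_self_eq_zero hx, norm_smul, mul_pow,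
    Real.norm_eq_abs, sq_abs]
  ring

lemma norm_smul_le (hB : SkewAdjointGraph (ip X) B) {x z : X} (hx : (x, z) ∈ B) (a : ℝ) :
    |a| * ‖x‖ ≤ ‖a • x - z‖ := by
  refine le_of_sq_le_sq ?_ (norm_nonneg _)
  rw [hB.norm_sq_smul_sub hx, mul_pow, sq_abs]
  nlinarith [sq_nonneg ‖z‖]

lemma isClosed (hB : SkewAdjointGraph (ip X) B) : IsClosed (B : Set (X × X)) := by
  have : (B : Set (X × X)) = ⋂ h ∈ B, {p | ⟪p.1, h.2⟫ = ⟪-p.2, h.1⟫} := by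
    ext ⟨x, z⟩
    simpa using hB x z
  rw [this]
  refine isClosed_biInter fun h _ => isClosed_eq ?_ ?_ <;> fun_prop

/-- The resolvent equation `a x - A x = f` has at most one solution. -/
lemma resolvent_unique (hB : SkewAdjointGraph (ip X) B) {a : ℝ} (ha : a ≠ 0) {f x y : X}
    (hx : (x, a • x - f) ∈ B) (hy : (y, a • y - f) ∈ B) : x = y := by
  have h := B.sub_mem hx hy
  have h1 := hB.norm_smul_le h a
  have h2 : a • (x - y) - (a • x - f - (a • y - f)) = 0 := by module
  simp only [h2, norm_zero] at h1
  have h3 : 0 < |a| := abs_pos.2 ha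
  have h4 : ‖x - y‖ ≤ 0 := by
    by_contra h5
    push Not at h5
    nlinarith
  exact sub_eq_zero.1 (norm_le_zero_iff.1 h4)

variable [CompleteSpace X]

/-- The resolvent of a skew-adjoint operator exists at every nonzero real number: the range of
`a - A` is closed since `‖a x - A x‖² = a² ‖x‖² + ‖A x‖²`, and an element orthogonal to it
is an eigenvector of `A` with the eigenvalue `-a`, which is real and nonzero, and so it vanishes. -/
lemma exists_resolvent (hB : SkewAdjointGraph (ip X) B) {a : ℝ} (ha : a ≠ 0) :
    ∃ R : X →L[ℝ] X, ∀ f, (R f, a • R f - f) ∈ B := by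
  have hcl : IsClosed (B : Set (X × X)) := hB.isClosed
  have : CompleteSpace B := hcl.completeSpace_coe
  let T : B →L[ℝ] X := (a • ContinuousLinearMap.fst ℝ X X - .snd ℝ X X) ∘L B.subtypeL
  have hT : ∀ h : B, T h = a • h.1.1 - h.1.2 := fun h => rfl
  have hbd : ∀ h : B, min |a| 1 * ‖h‖ ≤ ‖T h‖ := by
    intro h
    have h1 := hB.norm_smul_le h.2 a
    have h2 : ‖h.1.2‖ ≤ ‖T h‖ := by
      refine le_of_sq_le_sq ?_ (norm_nonneg _)
      rw [hT, hB.norm_sq_smul_sub h.2]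
      nlinarith [mul_nonneg (sq_nonneg a) (sq_nonneg ‖h.1.1‖)]
    rw [← hT] at h1
    change min |a| 1 * max ‖h.1.1‖ ‖h.1.2‖ ≤ _
    rcases max_cases ‖h.1.1‖ ‖h.1.2‖ with ⟨h3, _⟩ | ⟨h3, _⟩ <;> rw [h3]
    · exact (mul_le_mul_of_nonneg_right (min_le_left _ _) (norm_nonneg _)).trans h1
    · exact (mul_le_mul_of_nonneg_right (min_le_right _ _) (norm_nonneg _)).trans
        (by rwa [one_mul])
  have hmin : 0 < min |a| 1 := lt_min (abs_pos.2 ha) one_pos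
  have hanti : AntilipschitzWith (Real.toNNReal (min |a| 1)⁻¹) T := by
    refine AddMonoidHomClass.antilipschitz_of_bound T fun h => ?_
    rw [Real.coe_toNNReal _ (inv_nonneg.2 hmin.le), inv_mul_eq_div, le_div_iff₀' hmin]
    exact hbd h
  have hker : LinearMap.ker (T : B →ₗ[ℝ] X) = ⊥ := LinearMap.ker_eq_bot.2 hanti.injective
  have hrc : IsClosed (Set.range T) := hanti.isClosed_range T.uniformContinuous
  have hran : LinearMap.range (T : B →ₗ[ℝ] X) = ⊤ := by
    have : CompleteSpace (LinearMap.range (T : B →ₗ[ℝ] X)) := by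
      have : IsClosed ((LinearMap.range (T : B →ₗ[ℝ] X)) : Set X) := by
        rw [LinearMap.coe_range]; exact hrc
      exact this.completeSpace_coe
    rw [← Submodule.orthogonal_eq_bot_iff, Submodule.eq_bot_iff]
    intro w hw
    have hw' : ∀ h ∈ B, ⟪w, a • h.1 - h.2⟫ = 0 := by
      intro h hh
      rw [real_inner_comm]
      exact hw _ ⟨⟨h, hh⟩, rfl⟩
    have hmem : (w, -(a • w)) ∈ B := by
      refine (hB _ _).2 fun h hh => ?_
      have := hw' h hh
      rw [inner_sub_right, real_inner_smul_right] at this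
      simp only [ip_apply, neg_neg, real_inner_smul_left]
      linarith
    have h1 := hB.inner_self_eq_zero hmem
    rw [inner_neg_right, real_inner_smul_right, real_inner_self_eq_norm_sq] at h1
    have h2 : ‖w‖ ^ 2 = 0 := by
      rcases mul_eq_zero.1 (neg_eq_zero.1 h1) with h | h
      · exact absurd h ha
      · exact h
    simpa using h2
  let E := ContinuousLinearEquiv.ofBijective T hker hran
  refine ⟨.fst ℝ X X ∘L B.subtypeL ∘L (E.symm : X →L[ℝ] B), fun f => ?_⟩
  have h1 : T (E.symm f) = f := E.apply_symm_apply f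
  rw [hT] at h1
  have h2 := (E.symm f).2
  have h3 : a • (E.symm f).1.1 - f = (E.symm f).1.2 := by
    nth_rewrite 2 [← h1]; abel
  change ((E.symm f).1.1, a • (E.symm f).1.1 - f) ∈ B
  rw [h3]
  exact h2

open Classical in
/-- The resolvent `(a - A)⁻¹` of the operator `A` with graph `B` (with value `0` for `a = 0`). -/
noncomputable def res (_hB : SkewAdjointGraph (ip X) B) (a : ℝ) : X →L[ℝ] X :=
  if h : ∃ R : X →L[ℝ] X, ∀ f, (R f, a • R f - f) ∈ B then h.choose else 0

lemma res_mem (hB : SkewAdjointGraph (ip X) B) {a : ℝ} (ha : a ≠ 0) (f : X) :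
    (hB.res a f, a • hB.res a f - f) ∈ B := by
  have h := hB.exists_resolvent ha
  rw [res, dif_pos h]
  exact h.choose_spec f

lemma res_eq (hB : SkewAdjointGraph (ip X) B) {a : ℝ} (ha : a ≠ 0) {f x : X}
    (h : (x, a • x - f) ∈ B) : hB.res a f = x :=
  hB.resolvent_unique ha (hB.res_mem ha f) h

lemma norm_smul_res_le (hB : SkewAdjointGraph (ip X) B) {a : ℝ} (ha : a ≠ 0) (f : X) :
    ‖a • hB.res a f‖ ≤ ‖f‖ := by
  have := hB.norm_smul_le (hB.res_mem ha f) a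
  rwa [sub_sub_cancel, ← Real.norm_eq_abs, ← norm_smul] at this

lemma res_comm (hB : SkewAdjointGraph (ip X) B) {a b : ℝ} (ha : a ≠ 0) (hb : b ≠ 0) :
    Commute (hB.res a) (hB.res b) := by
  ext f
  change hB.res a (hB.res b f) = hB.res b (hB.res a f)
  have hq := hB.res_mem hb f
  set q := hB.res b f
  have hp := hB.res_mem ha q
  set p := hB.res a q
  symm
  have h1 : hB.res a f = (b - a) • p + q := by
    refine hB.res_eq ha ?_
    have := B.add_mem (B.smul_mem (b - a) hp) hq
    convert this using 1
    refine Prod.ext rfl ?_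
    simp only [Prod.snd_add, Prod.smul_snd]
    module
  rw [h1]
  refine hB.res_eq hb ?_
  convert hp using 1
  refine Prod.ext rfl ?_
  simp only
  module

lemma inner_res (hB : SkewAdjointGraph (ip X) B) {a : ℝ} (ha : a ≠ 0) (f g : X) :
    ⟪hB.res a f, g⟫ = -⟪f, hB.res (-a) g⟫ := by
  have h := hB.inner_eq (hB.res_mem ha f) (hB.res_mem (neg_ne_zero.2 ha) g)
  simp only [inner_sub_right, inner_sub_left, real_inner_smul_left, real_inner_smul_right] at h
  linarith

lemma smul_res_of_mem (hB : SkewAdjointGraph (ip X) B) {a : ℝ} (ha : a ≠ 0) {x z : X}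
    (h : (x, z) ∈ B) :
    a • hB.res a x = x + hB.res a z := by
  have : hB.res a x = a⁻¹ • (x + hB.res a z) := by
    refine hB.res_eq ha ?_
    have h1 := B.smul_mem a⁻¹ (B.add_mem h (hB.res_mem ha z))
    convert h1 using 1
    refine Prod.ext rfl ?_
    simp only [Prod.snd_add, Prod.smul_snd, smul_smul, mul_inv_cancel₀ ha]
    have : z + (a • hB.res a z - z) = a • hB.res a z := by abel
    rw [this, smul_smul, inv_mul_cancel₀ ha]
    module
  rw [this, smul_smul, mul_inv_cancel₀ ha, one_smul]

/-- The domain of a single-valued skew-adjoint operator is dense. -/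
lemma dense_fst (hB : SkewAdjointGraph (ip X) B) (h0 : ∀ z, (0, z) ∈ B → z = 0) :
    Dense ((B.map (LinearMap.fst ℝ X X) : Submodule ℝ X) : Set X) := by
  rw [Submodule.dense_iff_topologicalClosure_eq_top, Submodule.topologicalClosure_eq_top_iff,
    Submodule.eq_bot_iff]
  intro w hw
  refine h0 w ((hB _ _).2 fun h hh => ?_)
  have : ⟪w, h.1⟫ = 0 := by
    rw [real_inner_comm]
    exact hw _ ⟨h, hh, rfl⟩
  simp [this]

lemma tendsto_smul_res (hB : SkewAdjointGraph (ip X) B) (h0 : ∀ z, (0, z) ∈ B → z = 0)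
    {a : ℕ → ℝ} (ha : ∀ n, a n ≠ 0)
    (hlim : Tendsto (fun n => |a n|) atTop atTop) (x : X) :
    Tendsto (fun n => a n • hB.res (a n) x) atTop (𝓝 x) := by
  rw [Metric.tendsto_atTop]
  intro ε hε
  obtain ⟨_, ⟨⟨y, z⟩, hyz, rfl⟩, hy⟩ := (hB.dense_fst h0).exists_dist_lt x (half_pos (half_pos hε))
  simp only [LinearMap.fst_apply] at hy
  have hN := hlim.eventually_gt_atTop (‖z‖ / (ε / 2))
  obtain ⟨N, hN⟩ := eventually_atTop.1 hN
  refine ⟨N, fun n hn => ?_⟩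
  have h1 : a n • hB.res (a n) x - x
      = a n • hB.res (a n) (x - y) + (hB.res (a n) z + (y - x)) := by
    rw [map_sub, smul_sub, hB.smul_res_of_mem (ha n) hyz]; abel
  have h2 : ‖hB.res (a n) z‖ < ε / 2 := by
    have h3 := hB.norm_smul_res_le (ha n) z
    have h4 := hN n hn
    rw [div_lt_iff₀ (half_pos hε)] at h4
    rw [norm_smul, Real.norm_eq_abs] at h3
    exact lt_of_mul_lt_mul_left (h3.trans_lt h4) (abs_nonneg _)
  rw [dist_eq_norm, h1]
  have h5 := norm_add₃_le (a := a n • hB.res (a n) (x - y)) (b := hB.res (a n) z) (c := y - x)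
  have h6 := hB.norm_smul_res_le (ha n) (x - y)
  rw [dist_eq_norm] at hy
  have h7 : ‖y - x‖ = ‖x - y‖ := norm_sub_rev _ _
  rw [← add_assoc]
  linarith

/-- The symmetrized Yosida approximation
`(a² / 2) ((a - A)⁻¹ - (a + A)⁻¹) = A (1 - a⁻² A²)⁻¹`, with `a = n + 1`. Unlike the usual one it is
itself skew-adjoint. -/
noncomputable def yosida (hB : SkewAdjointGraph (ip X) B) (n : ℕ) : X →L[ℝ] X :=
  (((n : ℝ) + 1) ^ 2 / 2) • (hB.res (n + 1) + hB.res (-(n + 1)))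

lemma yosida_comm (hB : SkewAdjointGraph (ip X) B) (m n : ℕ) :
    Commute (hB.yosida m) (hB.yosida n) := by
  have hm : (m : ℝ) + 1 ≠ 0 := by positivity
  have hn : (n : ℝ) + 1 ≠ 0 := by positivity
  have hm' := neg_ne_zero.2 hm
  have hn' := neg_ne_zero.2 hn
  refine Commute.smul_left (Commute.smul_right ?_ _) _
  exact ((hB.res_comm hm hn).add_right (hB.res_comm hm hn')).add_left
    ((hB.res_comm hm' hn).add_right (hB.res_comm hm' hn'))

lemma inner_yosida (hB : SkewAdjointGraph (ip X) B) (n : ℕ) (x y : X) :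
    ⟪hB.yosida n x, y⟫ = -⟪x, hB.yosida n y⟫ := by
  have hn : (n : ℝ) + 1 ≠ 0 := by positivity
  have h1 := hB.inner_res hn x y
  have h2 := hB.inner_res (neg_ne_zero.2 hn) x y
  rw [neg_neg] at h2
  simp only [yosida, _root_.smul_apply, _root_.add_apply, real_inner_smul_left,
    real_inner_smul_right, inner_add_left, inner_add_right, h1, h2]
  ring

lemma tendsto_yosida (hB : SkewAdjointGraph (ip X) B) (h0 : ∀ z, (0, z) ∈ B → z = 0)
    {x z : X} (h : (x, z) ∈ B) :
    Tendsto (fun n => hB.yosida n x) atTop (𝓝 z) := by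
  have hn : ∀ n : ℕ, (n : ℝ) + 1 ≠ 0 := fun n => by positivity
  have hl : Tendsto (fun n : ℕ => |(n : ℝ) + 1|) atTop atTop :=
    tendsto_abs_atTop_atTop.comp (tendsto_atTop_add_const_right _ _ tendsto_natCast_atTop_atTop)
  have t1 := hB.tendsto_smul_res h0 hn hl z
  have t2 := hB.tendsto_smul_res h0 (a := fun n : ℕ => -((n : ℝ) + 1))
    (fun n => neg_ne_zero.2 (hn n)) (by simpa only [abs_neg] using hl) z
  have t3 := (t1.add t2).const_smul (1 / 2 : ℝ)
  have e : (1 / 2 : ℝ) • (z + z) = z := by module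
  rw [e] at t3
  refine t3.congr fun n => ?_
  have e1 := hB.smul_res_of_mem (hn n) h
  have e2 := hB.smul_res_of_mem (neg_ne_zero.2 (hn n)) h
  have e3 : hB.res ((n : ℝ) + 1) z = ((n : ℝ) + 1) • hB.res ((n : ℝ) + 1) x - x := by
    rw [e1]; abel
  have e4 : hB.res (-((n : ℝ) + 1)) z
      = (-((n : ℝ) + 1)) • hB.res (-((n : ℝ) + 1)) x - x := by
    rw [e2]; abel
  simp only [e3, e4, yosida, _root_.smul_apply, _root_.add_apply]
  module

end Hilbert

end SkewAdjointGraph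

namespace SkewAdjointGraph

section Bounded

variable {X : Type*} [NormedAddCommGroup X] [InnerProductSpace ℝ X] [CompleteSpace X]

lemma hasDerivAt_exp_smul_apply (T : X →L[ℝ] X) (x : X) (t : ℝ) :
    HasDerivAt (fun t : ℝ => NormedSpace.exp (t • T) x) (NormedSpace.exp (t • T) (T x)) t := by
  have h := hasDerivAt_exp_smul_const (𝕂 := ℝ) T t
  simpa using h.clm_apply (hasDerivAt_const t x)

lemma norm_exp_smul_apply {T : X →L[ℝ] X} (hT : ∀ x y, ⟪T x, y⟫ = -⟪x, T y⟫) (t : ℝ) (x : X) :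
    ‖NormedSpace.exp (t • T) x‖ = ‖x‖ := by
  have hc : ∀ t : ℝ, NormedSpace.exp (t • T) (T x) = T (NormedSpace.exp (t • T) x) := by
    intro t
    have : Commute (NormedSpace.exp (t • T)) T :=
      ((Commute.refl T).smul_left t).exp_left
    exact congrArg (fun S : X →L[ℝ] X => S x) this.eq
  have hd : ∀ t, HasDerivAt (fun t : ℝ => ‖NormedSpace.exp (t • T) x‖ ^ 2) 0 t := by
    intro t
    have h := (hasDerivAt_exp_smul_apply T x t).norm_sq
    convert h using 1
    rw [hc, real_inner_comm]
    have := hT (NormedSpace.exp (t • T) x) (NormedSpace.exp (t • T) x)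
    rw [real_inner_comm] at this
    rw [real_inner_comm]
    linarith
  have h1 := is_const_of_deriv_eq_zero (fun t => (hd t).differentiableAt)
    (fun t => (hd t).deriv) t 0
  simp only [zero_smul, NormedSpace.exp_zero] at h1
  exact (sq_eq_sq₀ (norm_nonneg _) (norm_nonneg _)).1 h1

lemma norm_exp_smul_apply_sub_le {T : X →L[ℝ] X} (hT : ∀ x y, ⟪T x, y⟫ = -⟪x, T y⟫) (t : ℝ)
    (x : X) : ‖NormedSpace.exp (t • T) x - x‖ ≤ |t| * ‖T x‖ := by
  have h := Convex.norm_image_sub_le_of_norm_hasDerivWithin_le (s := univ) (x := 0) (y := t)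
    (f := fun t : ℝ => NormedSpace.exp (t • T) x) (C := ‖T x‖)
    (fun s _ => (hasDerivAt_exp_smul_apply T x s).hasDerivWithinAt)
    (fun s _ => (norm_exp_smul_apply hT s (T x)).le) convex_univ (mem_univ _) (mem_univ _)
  simpa [mul_comm] using h

/-- Two commuting skew-adjoint operators generate groups whose distance is controlled by the
distance of the operators at each vector. -/
lemma norm_exp_sub_exp_le {T V : X →L[ℝ] X} (hT : ∀ x y, ⟪T x, y⟫ = -⟪x, T y⟫)
    (hV : ∀ x y, ⟪V x, y⟫ = -⟪x, V y⟫) (hc : Commute T V) (t : ℝ) (x : X) :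
    ‖NormedSpace.exp (t • T) x - NormedSpace.exp (t • V) x‖ ≤ |t| * ‖T x - V x‖ := by
  let _ : NormedAlgebra ℚ (X →L[ℝ] X) := NormedAlgebra.restrictScalars ℚ ℝ _
  have h1 : NormedSpace.exp (t • T)
      = NormedSpace.exp (t • V) * NormedSpace.exp (t • (T - V)) := by
    rw [← NormedSpace.exp_add_of_commute]
    · congr 1; module
    · exact ((hc.symm.sub_right (Commute.refl V)).smul_left t).smul_right t
  have h2 : NormedSpace.exp (t • T) x - NormedSpace.exp (t • V) x
      = NormedSpace.exp (t • V) (NormedSpace.exp (t • (T - V)) x - x) := by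
    rw [h1, map_sub]; rfl
  rw [h2, norm_exp_smul_apply hV]
  refine norm_exp_smul_apply_sub_le (T := T - V) (fun x y => ?_) t x
  simp only [_root_.sub_apply, inner_sub_left, inner_sub_right, hT, hV]
  ring

end Bounded

section Stone

variable {X : Type*} [NormedAddCommGroup X] [InnerProductSpace ℝ X] [CompleteSpace X]
  {B : Submodule ℝ (X × X)}

/-- The unitary groups generated by the Yosida approximations. -/
noncomputable def approxGroup (hB : SkewAdjointGraph (ip X) B) (n : ℕ) (t : ℝ) : X →L[ℝ] X :=
  NormedSpace.exp (t • hB.yosida n)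

lemma norm_approxGroup (hB : SkewAdjointGraph (ip X) B) (n : ℕ) (t : ℝ) (x : X) :
    ‖hB.approxGroup n t x‖ = ‖x‖ :=
  norm_exp_smul_apply (hB.inner_yosida n) t x

lemma hasDerivAt_approxGroup (hB : SkewAdjointGraph (ip X) B) (n : ℕ) (x : X) (t : ℝ) :
    HasDerivAt (fun t => hB.approxGroup n t x) (hB.approxGroup n t (hB.yosida n x)) t :=
  hasDerivAt_exp_smul_apply _ _ _

lemma uniformCauchySeqOn_approxGroup (hB : SkewAdjointGraph (ip X) B)
    (h0 : ∀ z, (0, z) ∈ B → z = 0) (x : X) (T : ℝ) :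
    UniformCauchySeqOn (fun n t => hB.approxGroup n t x) atTop {t | |t| < T} := by
  rw [Metric.uniformCauchySeqOn_iff]
  intro ε hε
  obtain ⟨_, ⟨⟨y, z⟩, hyz, rfl⟩, hy⟩ :=
    (hB.dense_fst h0).exists_dist_lt x (by positivity : 0 < ε / 4)
  simp only [LinearMap.fst_apply, dist_eq_norm] at hy
  have hcs := (hB.tendsto_yosida h0 hyz).cauchySeq
  rw [Metric.cauchySeq_iff] at hcs
  obtain ⟨N, hN⟩ := hcs (ε / (2 * (|T| + 1))) (by positivity)
  refine ⟨N, fun m hm n hn t ht => ?_⟩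
  have ht' : |t| ≤ |T| := (le_of_lt ht).trans (le_abs_self T)
  have h1 := norm_exp_sub_exp_le (hB.inner_yosida m) (hB.inner_yosida n) (hB.yosida_comm m n) t y
  have h2 := hN m hm n hn
  rw [dist_eq_norm, lt_div_iff₀ (by positivity)] at h2
  have h3 : |t| * ‖hB.yosida m y - hB.yosida n y‖ ≤
      |T| * ‖hB.yosida m y - hB.yosida n y‖ := mul_le_mul_of_nonneg_right ht' (norm_nonneg _)
  have h4 : hB.approxGroup m t x - hB.approxGroup n t x
      = hB.approxGroup m t (x - y) + (hB.approxGroup m t y - hB.approxGroup n t y)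
        + hB.approxGroup n t (y - x) := by
    simp only [map_sub]; abel
  have h5 := norm_add₃_le (a := hB.approxGroup m t (x - y))
    (b := hB.approxGroup m t y - hB.approxGroup n t y) (c := hB.approxGroup n t (y - x))
  rw [norm_approxGroup, norm_approxGroup, norm_sub_rev y x] at h5
  rw [dist_eq_norm, h4]
  have h6 : ‖hB.approxGroup m t y - hB.approxGroup n t y‖
      ≤ |t| * ‖hB.yosida m y - hB.yosida n y‖ := h1
  nlinarith [norm_nonneg (hB.yosida m y - hB.yosida n y)]

/-- **Stone's theorem**: a single-valued skew-adjoint operator in a real Hilbert space generates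
a strongly continuous group. -/
theorem exists_group (hB : SkewAdjointGraph (ip X) B) (h0 : ∀ z, (0, z) ∈ B → z = 0) :
    ∃ S : C0Group X, S.HasGenerator B := by
  have hlim : ∀ t x, ∃ y, Tendsto (fun n => hB.approxGroup n t x) atTop (𝓝 y) := fun t x =>
    cauchySeq_tendsto_of_complete
      ((hB.uniformCauchySeqOn_approxGroup h0 x (|t| + 1)).cauchySeq (by simp))
  choose f hf using hlim
  let S : ℝ → X →L[ℝ] X := fun t =>
    continuousLinearMapOfTendsto (fun n => hB.approxGroup n t) (f := f t)
      (tendsto_pi_nhds.2 fun x => hf t x)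
  have hS : ∀ t x, Tendsto (fun n => hB.approxGroup n t x) atTop (𝓝 (S t x)) := hf
  have hunif : ∀ x T, TendstoUniformlyOn (fun n t => hB.approxGroup n t x) (fun t => S t x) atTop
      {t | |t| < T} := fun x T =>
    (hB.uniformCauchySeqOn_approxGroup h0 x T).tendstoUniformlyOn_of_tendsto fun t _ => hS t x
  have hopen : ∀ T : ℝ, IsOpen {t : ℝ | |t| < T} := fun T =>
    isOpen_lt continuous_abs continuous_const
  have hcont : ∀ x, Continuous fun t => S t x := by
    intro x
    rw [continuous_iff_continuousAt]
    intro t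
    have h1 : ContinuousOn (fun t => S t x) {s | |s| < |t| + 1} :=
      (hunif x _).continuousOn (Eventually.of_forall fun n s _ =>
        (hB.hasDerivAt_approxGroup n x s).continuousAt.continuousWithinAt).frequently
    exact h1.continuousAt ((hopen _).mem_nhds (by simp))
  let _ : NormedAlgebra ℚ (X →L[ℝ] X) := NormedAlgebra.restrictScalars ℚ ℝ _
  have hadd : ∀ s t, S (s + t) = S s ∘L S t := by
    intro s t
    ext x
    refine tendsto_nhds_unique (hS (s + t) x) ?_
    have h1 : Tendsto (fun n => hB.approxGroup n s (hB.approxGroup n t x - S t x)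
        + hB.approxGroup n s (S t x)) atTop (𝓝 (0 + S s (S t x))) := by
      refine Tendsto.add ?_ (hS s _)
      rw [tendsto_zero_iff_norm_tendsto_zero]
      simp only [norm_approxGroup]
      rw [← tendsto_zero_iff_norm_tendsto_zero]
      exact tendsto_sub_nhds_zero_iff.2 (hS t x)
    rw [zero_add] at h1
    refine h1.congr fun n => ?_
    have h2 : hB.approxGroup n (s + t) = hB.approxGroup n s * hB.approxGroup n t := by
      rw [approxGroup, add_smul]
      exact NormedSpace.exp_add_of_commute (((Commute.refl _).smul_left s).smul_right t)
    rw [h2, map_sub, sub_add_cancel]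
    rfl
  have hzero : S 0 = ContinuousLinearMap.id ℝ X := by
    ext x
    refine tendsto_nhds_unique (hS 0 x) ?_
    simp [approxGroup]
  have hderiv : ∀ x z, (x, z) ∈ B → HasDerivAt (fun t => S t x) z 0 := by
    intro x z h
    have hu : TendstoUniformlyOn (fun n t => hB.approxGroup n t (hB.yosida n x))
        (fun t => S t z) atTop {t | |t| < 1} := by
      have h1 := Metric.tendstoUniformlyOn_iff.1 (hunif z 1)
      rw [Metric.tendstoUniformlyOn_iff]
      intro ε hε
      filter_upwards [h1 (ε / 2) (half_pos hε),
        Metric.tendsto_nhds.1 (hB.tendsto_yosida h0 h) (ε / 2) (half_pos hε)] with n h2 h3 t ht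
      have h4 := h2 t ht
      have h5 : dist (hB.approxGroup n t z) (hB.approxGroup n t (hB.yosida n x)) < ε / 2 := by
        rwa [dist_eq_norm, ← map_sub, norm_approxGroup, ← dist_eq_norm, dist_comm]
      exact (dist_triangle _ _ _).trans_lt (by linarith)
    have h6 := hasDerivAt_of_tendstoUniformlyOn (hopen 1) hu
      (Eventually.of_forall fun n t _ => hB.hasDerivAt_approxGroup n x t) (fun t _ => hS t x)
      (x := 0) (by simp)
    rwa [hzero] at h6
  have hskew : ∀ t x y, ⟪S t x, y⟫ = ⟪x, S (-t) y⟫ := by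
    have hn : ∀ t x, ‖S t x‖ = ‖x‖ := by
      intro t x
      refine tendsto_nhds_unique (hS t x).norm ?_
      simp only [norm_approxGroup]
      exact tendsto_const_nhds
    intro t x y
    have h1 : S t (S (-t) y) = y := by
      rw [← ContinuousLinearMap.comp_apply, ← hadd, add_neg_cancel, hzero]; rfl
    have h2 := (LinearMap.norm_map_iff_inner_map_map (S t)).1 (hn t) x (S (-t) y)
    rwa [h1] at h2
  refine ⟨⟨S, hzero, hadd, hcont⟩, fun x z => ⟨hderiv x z, fun hx => ?_⟩⟩
  refine (hB _ _).2 fun h hh => ?_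
  have h1 : HasDerivAt (fun t => ⟪S t x, h.1⟫) ⟪z, h.1⟫ 0 := by
    simpa using hx.inner ℝ (hasDerivAt_const (0 : ℝ) h.1)
  have h2 : HasDerivAt (fun t => ⟪S t x, h.1⟫) ⟪x, -h.2⟫ 0 := by
    have h3 : HasDerivAt (fun t => S (-t) h.1) (-h.2) 0 := by
      have := (neg_zero (G := ℝ)).symm ▸ hderiv h.1 h.2 hh
      simpa [Function.comp_def] using HasDerivAt.scomp (0 : ℝ) this (hasDerivAt_neg (0 : ℝ))
    simp only [hskew]
    simpa using (hasDerivAt_const (0 : ℝ) x).inner ℝ h3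
  have h3 := h1.unique h2
  rw [inner_neg_right] at h3
  simp [h3]

end Stone

end SkewAdjointGraph

/-! ### Skew-adjointness with respect to an equivalent inner product -/

section Coercive

variable {V : Type*} [NormedAddCommGroup V] [NormedSpace ℝ V] {a : V →L[ℝ] V →L[ℝ] ℝ}

lemma _root_.IsCoercive.apply_self_nonneg (ha : IsCoercive a) (x : V) : 0 ≤ a x x := by
  obtain ⟨C, hC, h⟩ := ha
  exact le_trans (by positivity) (h x)

lemma _root_.IsCoercive.eq_zero_of_apply_self (ha : IsCoercive a) {φ : V} (h : a φ φ = 0) :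
    φ = 0 := by
  obtain ⟨C, hC, hCa⟩ := ha
  have h1 := hCa φ
  rw [h] at h1
  by_contra hne
  have : 0 < ‖φ‖ := norm_pos_iff.2 hne
  have : 0 < C * ‖φ‖ * ‖φ‖ := by positivity
  linarith

lemma _root_.IsCoercive.eq_of_forall (ha : IsCoercive a) {φ φ' : V} (h : ∀ w, a φ w = a φ' w) :
    φ = φ' := by
  rw [← sub_eq_zero]
  refine ha.eq_zero_of_apply_self ?_
  have e : a (φ - φ') = a φ - a φ' := map_sub a φ φ'
  rw [e, _root_.sub_apply, h, sub_self]

end Coercive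

section EnergySpace

variable {X : Type*} [NormedAddCommGroup X] [NormedSpace ℝ X]

/-- The space `X` with the inner product given by a continuous, symmetric and coercive bilinear
form. It is equipped with the norm of this inner product, which is equivalent to that of `X`. -/
def EnergySpace (e : X →L[ℝ] X →L[ℝ] ℝ) (_hs : ∀ x y, e x y = e y x) (_hc : IsCoercive e) :
    Type _ := X

namespace EnergySpace

variable {e : X →L[ℝ] X →L[ℝ] ℝ} {hs : ∀ x y, e x y = e y x} {hc : IsCoercive e}

noncomputable instance : AddCommGroup (EnergySpace e hs hc) := inferInstanceAs (AddCommGroup X)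

noncomputable instance : Module ℝ (EnergySpace e hs hc) := inferInstanceAs (Module ℝ X)

/-- The identity map as a linear equivalence. -/
def linearEquiv (e : X →L[ℝ] X →L[ℝ] ℝ) (hs : ∀ x y, e x y = e y x) (hc : IsCoercive e) :
    X ≃ₗ[ℝ] EnergySpace e hs hc := LinearEquiv.refl ℝ X

/-- The inner product defined by the form. -/
@[reducible] noncomputable def core : InnerProductSpace.Core ℝ (EnergySpace e hs hc) where
  inner x y := e ((linearEquiv e hs hc).symm x) ((linearEquiv e hs hc).symm y)
  conj_inner_symm x y := by simpa using hs _ _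
  re_inner_nonneg x := by simpa using hc.apply_self_nonneg _
  add_left x y z := by simp
  smul_left x y r := by simp
  definite _ h := (LinearEquiv.map_eq_zero_iff _).1 (hc.eq_zero_of_apply_self h)

noncomputable instance : NormedAddCommGroup (EnergySpace e hs hc) := core.toNormedAddCommGroup

noncomputable instance : InnerProductSpace ℝ (EnergySpace e hs hc) :=
  InnerProductSpace.ofCore core.toCore

lemma inner_linearEquiv (x y : X) :
    ⟪linearEquiv e hs hc x, linearEquiv e hs hc y⟫ = e x y := rfl

lemma norm_sq_linearEquiv (x : X) : ‖linearEquiv e hs hc x‖ ^ 2 = e x x := by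
  rw [← real_inner_self_eq_norm_sq, inner_linearEquiv]

lemma norm_linearEquiv_le (x : X) : ‖linearEquiv e hs hc x‖ ≤ √‖e‖ * ‖x‖ := by
  refine le_of_sq_le_sq ?_ (by positivity)
  rw [norm_sq_linearEquiv, mul_pow, Real.sq_sqrt (norm_nonneg e)]
  have := (le_abs_self _).trans (e.le_opNorm₂ x x)
  rwa [mul_assoc, ← sq] at this

lemma exists_norm_le (hs : ∀ x y, e x y = e y x) (hc : IsCoercive e) :
    ∃ K : ℝ, ∀ x, ‖x‖ ≤ K * ‖linearEquiv e hs hc x‖ := by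
  have hc' := hc
  obtain ⟨C, hC, h⟩ := hc'
  refine ⟨√C⁻¹, fun x => ?_⟩
  refine le_of_sq_le_sq ?_ (by positivity)
  rw [mul_pow, norm_sq_linearEquiv, Real.sq_sqrt (inv_nonneg.2 hC.le), inv_mul_eq_div,
    le_div_iff₀ hC]
  have := h x
  nlinarith

/-- The identity map as an equivalence of topological vector spaces. -/
noncomputable def equiv (e : X →L[ℝ] X →L[ℝ] ℝ) (hs : ∀ x y, e x y = e y x) (hc : IsCoercive e) :
    X ≃L[ℝ] EnergySpace e hs hc :=
  (linearEquiv e hs hc).toContinuousLinearEquivOfBounds (√‖e‖) (exists_norm_le hs hc).choose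
    norm_linearEquiv_le fun y => by
      simpa using (exists_norm_le hs hc).choose_spec ((linearEquiv e hs hc).symm y)

instance [CompleteSpace X] : CompleteSpace (EnergySpace e hs hc) :=
  (completeSpace_congr (e := (equiv e hs hc).toEquiv) (equiv e hs hc).isUniformEmbedding).1
    inferInstance

end EnergySpace

end EnergySpace

namespace SkewAdjointGraph

variable {X : Type*} [NormedAddCommGroup X] [NormedSpace ℝ X]
  {e : X →L[ℝ] X →L[ℝ] ℝ} {B : Submodule ℝ (X × X)}

/-- A skew-adjoint operator as an operator in the associated Hilbert space. -/
noncomputable def toEnergy (hs : ∀ x y, e x y = e y x) (hc : IsCoercive e)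
    (B : Submodule ℝ (X × X)) :
    Submodule ℝ (EnergySpace e hs hc × EnergySpace e hs hc) :=
  B.comap ((EnergySpace.linearEquiv e hs hc).symm.prodCongr
    (EnergySpace.linearEquiv e hs hc).symm).toLinearMap

lemma mem_toEnergy {hs : ∀ x y, e x y = e y x} {hc : IsCoercive e} {x z : X} :
    (EnergySpace.equiv e hs hc x, EnergySpace.equiv e hs hc z) ∈ toEnergy hs hc B
      ↔ (x, z) ∈ B := Iff.rfl

lemma skewAdjoint_toEnergy (hB : SkewAdjointGraph e B) (hs : ∀ x y, e x y = e y x)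
    (hc : IsCoercive e) : SkewAdjointGraph (ip (EnergySpace e hs hc)) (toEnergy hs hc B) :=
  hB

lemma dense_domain [CompleteSpace X] (hB : SkewAdjointGraph e B) (hs : ∀ x y, e x y = e y x)
    (hc : IsCoercive e) (h0 : ∀ z, (0, z) ∈ B → z = 0) : Dense {x | ∃ z, (x, z) ∈ B} := by
  have h1 := (hB.skewAdjoint_toEnergy hs hc).dense_fst h0
  have h2 := (EnergySpace.equiv e hs hc).symm.surjective.denseRange.dense_image
    (EnergySpace.equiv e hs hc).symm.continuous h1
  refine h2.mono ?_
  rintro _ ⟨_, ⟨⟨x, z⟩, h, rfl⟩, rfl⟩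
  exact ⟨z, h⟩

/-- Stone's theorem for an operator that is skew-adjoint with respect to an equivalent inner
product. -/
lemma exists_group_of_coercive [CompleteSpace X] (hB : SkewAdjointGraph e B)
    (hs : ∀ x y, e x y = e y x) (hc : IsCoercive e) (h0 : ∀ z, (0, z) ∈ B → z = 0) :
    ∃ S : C0Group X, S.HasGenerator B := by
  obtain ⟨S, hS⟩ := (hB.skewAdjoint_toEnergy hs hc).exists_group h0
  let Φ := EnergySpace.equiv e hs hc
  refine ⟨⟨fun t => (Φ.symm : EnergySpace e hs hc →L[ℝ] X) ∘L S.op t ∘L 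
    (Φ : X →L[ℝ] EnergySpace e hs hc), ?_, ?_, ?_⟩, ?_⟩
  · ext x; simp [S.op_zero]
  · intro s t; ext x; simp [S.op_add]
  · intro x
    exact Φ.symm.continuous.comp (S.continuous_op (Φ x))
  · intro x z
    rw [← mem_toEnergy (hs := hs) (hc := hc), hS]
    constructor
    · intro h
      simpa using! (Φ.symm : EnergySpace e hs hc →L[ℝ] X).hasFDerivAt.comp_hasDerivAt (0 : ℝ) h
    · intro h
      have := (Φ : X →L[ℝ] EnergySpace e hs hc).hasFDerivAt.comp_hasDerivAt (0 : ℝ) h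
      refine this.congr_of_eventuallyEq (Eventually.of_forall fun t => ?_)
      simp [Φ]

end SkewAdjointGraph

/-! ### Groups generated by skew-adjoint operators -/

namespace C0Group

variable {X : Type*} [NormedAddCommGroup X] [NormedSpace ℝ X] (S : C0Group X)

lemma op_op (s t : ℝ) (x : X) : S.op s (S.op t x) = S.op (s + t) x := by
  rw [S.op_add]; rfl

lemma op_zero_apply (x : X) : S.op 0 x = x := by
  rw [S.op_zero]; rfl

namespace HasGenerator

variable {S} {B : Submodule ℝ (X × X)}

lemma hasDerivAt (hS : S.HasGenerator B) {x z : X} (h : (x, z) ∈ B) (t : ℝ) :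
    HasDerivAt (fun t => S.op t x) (S.op t z) t := by
  have h1 : HasDerivAt (fun s => S.op s x) z (t - t) := by
    rw [sub_self]; exact (hS x z).1 h
  have h2 := HasDerivAt.comp_sub_const t t h1
  have h3 := (S.op t).hasFDerivAt.comp_hasDerivAt t h2
  refine h3.congr_of_eventuallyEq (Eventually.of_forall fun s => ?_)
  simp [S.op_op]

lemma eq_zero_of_mem (hS : S.HasGenerator B) {z : X} (h : (0, z) ∈ B) : z = 0 := by
  have h1 := (hS 0 z).1 h
  simp only [map_zero] at h1
  exact h1.unique (hasDerivAt_const _ _)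

variable {e : X →L[ℝ] X →L[ℝ] ℝ}

/-- A group with skew-adjoint generator preserves the inner product. -/
lemma form_op_op [CompleteSpace X] (hS : S.HasGenerator B) (hB : SkewAdjointGraph e B)
    (hs : ∀ x y, e x y = e y x) (hc : IsCoercive e) (t : ℝ) (x y : X) :
    e (S.op t x) (S.op t y) = e x y := by
  have hd := hB.dense_domain hs hc fun z hz => hS.eq_zero_of_mem hz
  have key : ∀ x ∈ {x | ∃ z, (x, z) ∈ B}, ∀ y ∈ {x | ∃ z, (x, z) ∈ B},
      e (S.op t x) (S.op t y) = e x y := by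
    rintro x ⟨z, hz⟩ y ⟨w, hw⟩
    have h1 : ∀ t, HasDerivAt (fun t => e (S.op t x) (S.op t y)) 0 t := by
      intro t
      have h2 := (e.hasFDerivAt.comp_hasDerivAt t (hS.hasDerivAt hz t)).clm_apply
        (hS.hasDerivAt hw t)
      have h3 := (hB _ _).1 (hS.map_mem t _ hz) _ (hS.map_mem t _ hw)
      change e (S.op t x) (S.op t w) = e (-(S.op t z)) (S.op t y) at h3
      exact h2.congr_deriv (by simp [h3])
    have h4 := is_const_of_deriv_eq_zero (fun t => (h1 t).differentiableAt)
      (fun t => (h1 t).deriv) t 0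
    simpa [S.op_zero_apply] using h4
  have c2 : ∀ x ∈ {x | ∃ z, (x, z) ∈ B}, ∀ y, e (S.op t x) (S.op t y) = e x y := by
    intro x hx y
    refine congrFun (Continuous.ext_on hd (f := fun y => e (S.op t x) (S.op t y)) ?_ ?_
      (key x hx)) y <;> fun_prop
  refine congrFun (Continuous.ext_on hd (f := fun x => e (S.op t x) (S.op t y))
    (g := fun x => e x y) ?_ ?_ (fun x hx => c2 x hx y)) x <;> fun_prop

lemma form_op_left [CompleteSpace X] (hS : S.HasGenerator B) (hB : SkewAdjointGraph e B)
    (hs : ∀ x y, e x y = e y x) (hc : IsCoercive e) (t : ℝ) (x y : X) :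
    e (S.op t x) y = e x (S.op (-t) y) := by
  have := hS.form_op_op hB hs hc t x (S.op (-t) y)
  rwa [S.op_op, add_neg_cancel, S.op_zero_apply] at this

lemma exists_bound [CompleteSpace X] (hS : S.HasGenerator B) (hB : SkewAdjointGraph e B)
    (hs : ∀ x y, e x y = e y x) (hc : IsCoercive e) :
    ∃ K : ℝ, ∀ t x, ‖S.op t x‖ ≤ K * ‖x‖ := by
  obtain ⟨K, hK⟩ := EnergySpace.exists_norm_le hs hc
  refine ⟨|K| * √‖e‖, fun t x => ?_⟩
  have h1 : ‖EnergySpace.linearEquiv e hs hc (S.op t x)‖ = ‖EnergySpace.linearEquiv e hs hc x‖ := by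
    rw [← sq_eq_sq₀ (norm_nonneg _) (norm_nonneg _), EnergySpace.norm_sq_linearEquiv,
      EnergySpace.norm_sq_linearEquiv, hS.form_op_op hB hs hc]
  calc ‖S.op t x‖ ≤ K * ‖EnergySpace.linearEquiv e hs hc (S.op t x)‖ := hK _
    _ ≤ |K| * ‖EnergySpace.linearEquiv e hs hc x‖ := by
      rw [h1]; exact mul_le_mul_of_nonneg_right (le_abs_self K) (norm_nonneg _)
    _ ≤ |K| * (√‖e‖ * ‖x‖) :=
      mul_le_mul_of_nonneg_left (EnergySpace.norm_linearEquiv_le x) (abs_nonneg K)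
    _ = _ := by ring

end HasGenerator

/-- A uniformly bounded group is jointly continuous. -/
lemma continuous_uncurry_op {K : ℝ} (hK : ∀ t x, ‖S.op t x‖ ≤ K * ‖x‖) :
    Continuous fun p : ℝ × X => S.op p.1 p.2 := by
  rw [continuous_iff_continuousAt]
  rintro ⟨t, x⟩
  have h1 : Tendsto (fun p : ℝ × X => S.op p.1 (p.2 - x)) (𝓝 (t, x)) (𝓝 0) := by
    refine squeeze_zero_norm (fun p => hK p.1 (p.2 - x)) ?_
    have : Continuous fun p : ℝ × X => K * ‖p.2 - x‖ := by fun_prop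
    simpa using this.tendsto (t, x)
  have h2 : Tendsto (fun p : ℝ × X => S.op p.1 x) (𝓝 (t, x)) (𝓝 (S.op t x)) :=
    ((S.continuous_op x).tendsto t).comp continuous_fst.continuousAt
  have h3 := h1.add h2
  rw [zero_add] at h3
  refine h3.congr fun p => ?_
  simp

/-- If `q` is differentiable, then so is `s ↦ S(s) (q(s) - q(t))` at `t`. -/
lemma hasDerivAt_op_sub {K : ℝ} (hK : ∀ t x, ‖S.op t x‖ ≤ K * ‖x‖) {q : ℝ → X} {q' : X} {t : ℝ}
    (hq : HasDerivAt q q' t) : HasDerivAt (fun s => S.op s (q s - q t)) (S.op t q') t := by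
  rw [hasDerivAt_iff_tendsto_slope] at hq ⊢
  have h1 : Tendsto (fun s => ((s, slope q t s) : ℝ × X)) (𝓝[≠] t) (𝓝 (t, q')) :=
    (tendsto_nhdsWithin_of_tendsto_nhds tendsto_id).prodMk_nhds hq
  refine (((S.continuous_uncurry_op hK).tendsto (t, q')).comp h1).congr fun s => ?_
  simp [slope_def_module]

end C0Group

/-! ### The state space -/

instance instCompleteSpaceH02 (Ω : Set Plane) : CompleteSpace (H02 Ω) :=
  (Submodule.isClosed_topologicalClosure _).completeSpace_coe

instance instCompleteSpaceY (Ω : Set Plane) : CompleteSpace (Y Ω) :=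
  inferInstanceAs (CompleteSpace (H1 × L2Half × H02 Ω × L2On Ω))

/-- The state with components `φ, ψ, u, v`. -/
def Y.mk {Ω : Set Plane} (φ : H1) (ψ : L2Half) (u : H02 Ω) (v : L2On Ω) : Y Ω := (φ, ψ, u, v)

@[simp] lemma Y.phi_mk {Ω : Set Plane} (φ : H1) (ψ : L2Half) (u : H02 Ω) (v : L2On Ω) :
    Y.phi (Y.mk φ ψ u v) = φ := rfl

@[simp] lemma Y.psi_mk {Ω : Set Plane} (φ : H1) (ψ : L2Half) (u : H02 Ω) (v : L2On Ω) :
    Y.psi (Y.mk φ ψ u v) = ψ := rfl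

@[simp] lemma Y.u_mk {Ω : Set Plane} (φ : H1) (ψ : L2Half) (u : H02 Ω) (v : L2On Ω) :
    Y.u (Y.mk φ ψ u v) = u := rfl

@[simp] lemma Y.v_mk {Ω : Set Plane} (φ : H1) (ψ : L2Half) (u : H02 Ω) (v : L2On Ω) :
    Y.v (Y.mk φ ψ u v) = v := rfl

lemma Y.ext {Ω : Set Plane} {y z : Y Ω} (h1 : Y.phi y = Y.phi z) (h2 : Y.psi y = Y.psi z)
    (h3 : Y.u y = Y.u z) (h4 : Y.v y = Y.v z) : y = z :=
  Prod.ext h1 (Prod.ext h2 (Prod.ext h3 h4))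

/-- The inclusion `φ ↦ (φ, 0; 0, 0)`. -/
noncomputable def Y.ofPhi (Ω : Set Plane) : H1 →L[ℝ] Y Ω :=
  ((Y.equiv Ω).symm : H1 × L2Half × H02 Ω × L2On Ω →L[ℝ] Y Ω) ∘L .inl ℝ _ _

@[simp] lemma Y.phi_ofPhi {Ω : Set Plane} (φ : H1) : Y.phi (Y.ofPhi Ω φ) = φ := rfl

@[simp] lemma Y.psi_ofPhi {Ω : Set Plane} (φ : H1) : Y.psi (Y.ofPhi Ω φ) = 0 := rfl

@[simp] lemma Y.u_ofPhi {Ω : Set Plane} (φ : H1) : Y.u (Y.ofPhi Ω φ) = 0 := rfl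

@[simp] lemma Y.v_ofPhi {Ω : Set Plane} (φ : H1) : Y.v (Y.ofPhi Ω φ) = 0 := rfl

lemma energyInner_comm (Ω : Set Plane) (μ : ℝ) (y z : Y Ω) :
    energyInner Ω μ y z = energyInner Ω μ z y := by
  simp only [energyInner_apply, opA_apply]
  simp only [real_inner_comm]

lemma inner_zeroExt (Ω : Set Plane) (g : L2On Ω) (f : L2Plane) :
    ⟪zeroExt Ω g, f⟫ = ⟪g, restr Ω f⟫ :=
  ContinuousLinearMap.adjoint_inner_left _ _ _

/-! ### The inhomogeneous evolution equation in the extended space -/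

/-- The state `(U N ∂_x u, 0; 0, 0)`. Applying `𝔸` to it in the extended space gives `ℙ_# [u]` up
to an element of `Y`. -/
noncomputable def liftState (Ω : Set Plane) (U : ℝ) {μ : ℝ} (hμ : 0 < μ) : H02 Ω →L[ℝ] Y Ω :=
  U • (Y.ofPhi Ω ∘L neumannMap hμ ∘L zeroExt Ω ∘L H02.d Ω 0)

/-- The state `(U² N ∂_x² u, 0; 0, 0)`. -/
noncomputable def liftRemainder (Ω : Set Plane) (U : ℝ) {μ : ℝ} (hμ : 0 < μ) :
    H02 Ω →L[ℝ] Y Ω :=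
  U ^ 2 • (Y.ofPhi Ω ∘L neumannMap hμ ∘L zeroExt Ω ∘L H02.dd Ω 0 0)

/-- The functional `ℙ_# [u]` is in the range of the extended generator modulo `Y`. This is where
two derivatives of `u` are used. -/
lemma Psharp_eq (Ω : Set Plane) (U : ℝ) {μ : ℝ} (hμ : 0 < μ) (u : H02 Ω) :
    Psharp Ω U hμ u
      = extA Ω U hμ (liftState Ω U hμ u) + embed Ω U hμ (liftRemainder Ω U hμ u) := by
  ext h
  rw [_root_.add_apply, extA_apply, embed_apply, Psharp_apply, psiTrace_apply,
    energyInner_apply, energyInner_apply]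
  simp only [liftState, liftRemainder, _root_.smul_apply, ContinuousLinearMap.comp_apply,
    map_smul, Y.phi_ofPhi, Y.psi_ofPhi, Y.u_ofPhi, Y.v_ofPhi, opA_neumannMap, smul_zero,
    map_zero, inner_zero_left, smul_eq_mul, inner_zeroExt]
  rw [real_inner_comm (H02.d Ω 0 u), real_inner_comm (H02.dd Ω 0 0 u)]
  ring

section Group

variable {Ω : Set Plane} {U μ : ℝ} {hμ : 0 < μ} {S : C0Group (Y Ω)}

lemma hasDerivAt_form_op (hS : S.HasGenerator (bbA Ω U hμ))
    (hB : SkewAdjointGraph (energyInner Ω μ) (bbA Ω U hμ)) (hc : IsCoercive (energyInner Ω μ))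
    (x : Y Ω) (h : DomA Ω U hμ) (t : ℝ) :
    HasDerivAt (fun t => embed Ω U hμ (S.op t x) h) (extA Ω U hμ (S.op t x) h) t := by
  have h1 : HasDerivAt (fun t => S.op (-t) (DomA.val Ω U hμ h))
      (-S.op (-t) (DomA.app Ω U hμ h)) t := by
    have := HasDerivAt.scomp t (hS.hasDerivAt h.2 (-t)) (hasDerivAt_neg t)
    simpa [Function.comp_def] using! this
  have h2 := (energyInner Ω μ x).hasFDerivAt.comp_hasDerivAt t h1
  rw [map_neg, ← hS.form_op_left hB (energyInner_comm Ω μ) hc] at h2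
  refine h2.congr_of_eventuallyEq (Eventually.of_forall fun s => ?_)
  exact hS.form_op_left hB (energyInner_comm Ω μ) hc s x _

/-- In the extended space, every orbit of the group is continuously differentiable. -/
lemma hasDerivAt_embed_op (hS : S.HasGenerator (bbA Ω U hμ))
    (hB : SkewAdjointGraph (energyInner Ω μ) (bbA Ω U hμ)) (hc : IsCoercive (energyInner Ω μ))
    (x : Y Ω) (t : ℝ) :
    HasDerivAt (fun t => embed Ω U hμ (S.op t x)) (extA Ω U hμ (S.op t x)) t := by
  have hcont : Continuous fun t => extA Ω U hμ (S.op t x) :=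
    (extA Ω U hμ).continuous.comp (S.continuous_op x)
  have h1 : ∀ t, embed Ω U hμ (S.op t x)
      = embed Ω U hμ x + ∫ s in (0 : ℝ)..t, extA Ω U hμ (S.op s x) := by
    intro t
    ext h
    rw [_root_.add_apply, ContinuousLinearMap.intervalIntegral_apply
      (hcont.intervalIntegrable _ _), intervalIntegral.integral_eq_sub_of_hasDerivAt
      (fun s _ => hasDerivAt_form_op hS hB hc x h s)
      ((hcont.clm_apply continuous_const).intervalIntegrable _ _), S.op_zero_apply]
    ring
  simp_rw [h1]
  exact ((hcont.integral_hasStrictDerivAt 0 t).hasDerivAt).const_add _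

lemma hasDerivAt_embed_op_comp (hS : S.HasGenerator (bbA Ω U hμ))
    (hB : SkewAdjointGraph (energyInner Ω μ) (bbA Ω U hμ)) (hc : IsCoercive (energyInner Ω μ))
    {q : ℝ → Y Ω} {q' : Y Ω} {t : ℝ} (hq : HasDerivAt q q' t) :
    HasDerivAt (fun s => embed Ω U hμ (S.op s (q s)))
      (extA Ω U hμ (S.op t (q t)) + embed Ω U hμ (S.op t q')) t := by
  obtain ⟨K, hK⟩ := hS.exists_bound hB (energyInner_comm Ω μ) hc
  have h1 := (hasDerivAt_embed_op hS hB hc (q t) t).add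
    ((embed Ω U hμ).hasFDerivAt.comp_hasDerivAt t (S.hasDerivAt_op_sub hK hq))
  refine h1.congr_of_eventuallyEq (Eventually.of_forall fun s => ?_)
  simp

lemma extGroup_embed (hS : S.HasGenerator (bbA Ω U hμ))
    (hB : SkewAdjointGraph (energyInner Ω μ) (bbA Ω U hμ)) (hc : IsCoercive (energyInner Ω μ))
    (t : ℝ) (x : Y Ω) : extGroup hS t (embed Ω U hμ x) = embed Ω U hμ (S.op t x) := by
  ext h
  exact (hS.form_op_left hB (energyInner_comm Ω μ) hc t x _).symm

lemma extGroup_extA (hS : S.HasGenerator (bbA Ω U hμ))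
    (hB : SkewAdjointGraph (energyInner Ω μ) (bbA Ω U hμ)) (hc : IsCoercive (energyInner Ω μ))
    (t : ℝ) (x : Y Ω) : extGroup hS t (extA Ω U hμ x) = extA Ω U hμ (S.op t x) := by
  ext h
  exact congrArg Neg.neg (hS.form_op_left hB (energyInner_comm Ω μ) hc t x _).symm

lemma extGroup_Psharp (hS : S.HasGenerator (bbA Ω U hμ))
    (hB : SkewAdjointGraph (energyInner Ω μ) (bbA Ω U hμ)) (hc : IsCoercive (energyInner Ω μ))
    (t : ℝ) (u : H02 Ω) : extGroup hS t (Psharp Ω U hμ u)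
      = extA Ω U hμ (S.op t (liftState Ω U hμ u))
        + embed Ω U hμ (S.op t (liftRemainder Ω U hμ u)) := by
  rw [Psharp_eq, ← extGroup_extA hS hB hc, ← extGroup_embed hS hB hc]
  rfl

/-- The variation of parameters formula with the inhomogeneity `ℙ_# [ū]`. With `w` and `r` the
lift and its remainder, the solution is `y(t) = S(t) p(t) - w(t)`, where
`p(t) = y₀ + w(0) + ∫₀ᵗ S(-s) (w'(s) + r(s)) ds`; it takes values in `Y` because the integration
by parts in time replaces `𝔸 w` by `w'`. -/
theorem exists_mild_solution (hS : S.HasGenerator (bbA Ω U hμ))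
    (hB : SkewAdjointGraph (energyInner Ω μ) (bbA Ω U hμ)) (hc : IsCoercive (energyInner Ω μ))
    {T : ℝ} (hT : 0 < T) {ubar : ℝ → H02 Ω} (hu : ContDiffOn ℝ 1 ubar (Icc 0 T)) (y₀ : Y Ω) :
    (∀ t ∈ Icc 0 T, IntervalIntegrable
      (fun s => extGroup hS (t - s) (Psharp Ω U hμ (ubar s))) volume 0 t) ∧
    ∃ y : ℝ → Y Ω,
      (∀ t ∈ Icc 0 T, embed Ω U hμ (y t) = embed Ω U hμ (S.op t y₀)
        + ∫ s in (0 : ℝ)..t, extGroup hS (t - s) (Psharp Ω U hμ (ubar s))) ∧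
      ContinuousOn y (Icc 0 T) ∧
      ContDiffOn ℝ 1 (fun t => embed Ω U hμ (y t)) (Ioo 0 T) ∧
      (∀ t ∈ Ioo 0 T, HasDerivAt (fun t => embed Ω U hμ (y t))
        (extA Ω U hμ (y t) + Psharp Ω U hμ (ubar t)) t) ∧
      y 0 = y₀ := by
  obtain ⟨K, hK⟩ := hS.exists_bound hB (energyInner_comm Ω μ) hc
  have hjc := S.continuous_uncurry_op hK
  have huc : ContinuousOn ubar (Icc 0 T) := hu.continuousOn
  have hud : ∀ t ∈ Ioo 0 T, HasDerivAt ubar (derivWithin ubar (Icc 0 T) t) t := by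
    intro t ht
    have h1 := (hu.differentiableOn one_ne_zero t (Ioo_subset_Icc_self ht)).hasDerivWithinAt
    exact h1.hasDerivAt (Icc_mem_nhds ht.1 ht.2)
  have hu'c : ContinuousOn (derivWithin ubar (Icc 0 T)) (Icc 0 T) :=
    hu.continuousOn_derivWithin (uniqueDiffOn_Icc hT) le_rfl
  -- `g = w' + r`, extended continuously to the whole line
  let g₀ : ℝ → Y Ω := fun s =>
    liftState Ω U hμ (derivWithin ubar (Icc 0 T) s) + liftRemainder Ω U hμ (ubar s)
  have hg₀ : ContinuousOn g₀ (Icc 0 T) :=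
    ((liftState Ω U hμ).continuous.comp_continuousOn hu'c).add
      ((liftRemainder Ω U hμ).continuous.comp_continuousOn huc)
  let g : ℝ → Y Ω := IccExtend hT.le ((Icc 0 T).domRestrict g₀)
  have hg : Continuous g := (continuousOn_iff_continuous_domRestrict.1 hg₀).Icc_extend'
  have hgeq : ∀ s ∈ Icc 0 T, g s = g₀ s := fun s hs => IccExtend_of_mem hT.le _ hs
  let w : ℝ → Y Ω := fun s => liftState Ω U hμ (ubar s)
  have hwc : ContinuousOn w (Icc 0 T) := (liftState Ω U hμ).continuous.comp_continuousOn huc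
  have hwd : ∀ t ∈ Ioo 0 T,
      HasDerivAt w (liftState Ω U hμ (derivWithin ubar (Icc 0 T) t)) t := fun t ht =>
    (liftState Ω U hμ).hasFDerivAt.comp_hasDerivAt t (hud t ht)
  have hSg : Continuous fun s => S.op (-s) (g s) := hjc.comp (continuous_neg.prodMk hg)
  let p : ℝ → Y Ω := fun t => y₀ + w 0 + ∫ s in (0 : ℝ)..t, S.op (-s) (g s)
  have hpd : ∀ t, HasDerivAt p (S.op (-t) (g t)) t := fun t =>
    (hSg.integral_hasStrictDerivAt 0 t).hasDerivAt.const_add _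
  have hpc : Continuous p := continuous_iff_continuousAt.2 fun t => (hpd t).continuousAt
  have hp0 : p 0 = y₀ + w 0 := by simp [p]
  let y : ℝ → Y Ω := fun t => S.op t (p t) - w t
  have hy0 : y 0 = y₀ := by simp [y, hp0, S.op_zero_apply]
  have hyc : ContinuousOn y (Icc 0 T) :=
    (hjc.comp (continuous_id.prodMk hpc)).continuousOn.sub hwc
  have hyd : ∀ t ∈ Ioo 0 T, HasDerivAt (fun t => embed Ω U hμ (y t))
      (extA Ω U hμ (y t) + Psharp Ω U hμ (ubar t)) t := by
    intro t ht
    have h1 := (hasDerivAt_embed_op_comp hS hB hc (hpd t)).sub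
      ((embed Ω U hμ).hasFDerivAt.comp_hasDerivAt t (hwd t ht))
    refine (h1.congr_of_eventuallyEq (Eventually.of_forall fun s => ?_)).congr_deriv ?_
    · simp [y]
    · rw [S.op_op, add_neg_cancel, S.op_zero_apply, hgeq t (Ioo_subset_Icc_self ht), Psharp_eq]
      simp only [y, w, g₀, map_sub, map_add]
      abel
  have hFc : ∀ t, ContinuousOn (fun s => extGroup hS (t - s) (Psharp Ω U hμ (ubar s)))
      (Icc 0 T) := by
    intro t
    simp only [extGroup_Psharp hS hB hc]
    have hts : ContinuousOn (fun s : ℝ => t - s) (Icc 0 T) := by fun_prop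
    exact ((extA Ω U hμ).continuous.comp_continuousOn
        (hjc.comp_continuousOn (hts.prodMk hwc))).add
      ((embed Ω U hμ).continuous.comp_continuousOn (hjc.comp_continuousOn
        (hts.prodMk ((liftRemainder Ω U hμ).continuous.comp_continuousOn huc))))
  have hint : ∀ t ∈ Icc 0 T, IntervalIntegrable
      (fun s => extGroup hS (t - s) (Psharp Ω U hμ (ubar s))) volume 0 t := by
    intro t ht
    refine ((hFc t).mono ?_).intervalIntegrable
    rw [uIcc_of_le ht.1]
    exact Icc_subset_Icc_right ht.2
  refine ⟨hint, y, fun t ht => ?_, hyc, ?_, hyd, hy0⟩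
  · -- `s ↦ S(t - s) y(s) = S(t) p(s) - S(t - s) w(s)` is an antiderivative of the integrand
    have hE : ∀ s, S.op (t - s) (y s) = S.op t (p s) - S.op (t - s) (w s) := by
      intro s
      simp only [y, map_sub, S.op_op, sub_add_cancel]
    have hc1 : ContinuousOn (fun s => embed Ω U hμ (S.op (t - s) (y s))) (Icc 0 t) := by
      have hts : ContinuousOn (fun s : ℝ => t - s) (Icc 0 t) := by fun_prop
      exact (embed Ω U hμ).continuous.comp_continuousOn
        (hjc.comp_continuousOn (hts.prodMk (hyc.mono (Icc_subset_Icc_right ht.2))))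
    have hd1 : ∀ s ∈ Ioo 0 t, HasDerivAt (fun s => embed Ω U hμ (S.op (t - s) (y s)))
        (extGroup hS (t - s) (Psharp Ω U hμ (ubar s))) s := by
      intro s hs
      have hsT : s ∈ Ioo 0 T := ⟨hs.1, hs.2.trans_le ht.2⟩
      have h1 : HasDerivAt (fun s => embed Ω U hμ (S.op t (p s)))
          (embed Ω U hμ (S.op t (S.op (-s) (g s)))) s :=
        ((embed Ω U hμ) ∘L (S.op t)).hasFDerivAt.comp_hasDerivAt s (hpd s)
      have h2 : HasDerivAt (fun s => embed Ω U hμ (S.op (t - s) (w s)))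
          (-extA Ω U hμ (S.op (t - s) (w s)) + embed Ω U hμ (S.op (t - s)
            (liftState Ω U hμ (derivWithin ubar (Icc 0 T) s)))) s := by
        have h3 : HasDerivAt (fun τ => w (t - τ))
            (-liftState Ω U hμ (derivWithin ubar (Icc 0 T) s)) (t - s) := by
          have h4 := hwd s hsT
          rw [← sub_sub_cancel t s] at h4
          have h5 := HasDerivAt.scomp (t - s) h4 ((hasDerivAt_id (t - s)).const_sub t)
          simpa [Function.comp_def] using! h5
        have h6 := hasDerivAt_embed_op_comp hS hB hc h3
        have h7 := HasDerivAt.scomp s h6 ((hasDerivAt_id s).const_sub t)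
        simpa [Function.comp_def] using! h7
      refine ((h1.sub h2).congr_of_eventuallyEq (Eventually.of_forall fun r => ?_)).congr_deriv ?_
      · simp [hE]
      · rw [extGroup_Psharp hS hB hc, S.op_op, ← sub_eq_add_neg,
          hgeq s (Ioo_subset_Icc_self hsT)]
        simp only [g₀, w, map_add]
        abel
    have h1 := intervalIntegral.integral_eq_sub_of_hasDerivAt_of_le ht.1 hc1 hd1 (hint t ht)
    rw [h1, sub_self, S.op_zero_apply, sub_zero, hy0]
    abel
  · have h1 : ContinuousOn (fun t => extA Ω U hμ (y t) + Psharp Ω U hμ (ubar t)) (Ioo 0 T) :=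
      ((extA Ω U hμ).continuous.comp_continuousOn (hyc.mono Ioo_subset_Icc_self)).add
        ((Psharp Ω U hμ).continuous.comp_continuousOn (huc.mono Ioo_subset_Icc_self))
    have h2 : ContDiffOn ℝ (0 + 1) (fun t => embed Ω U hμ (y t)) (Ioo 0 T) := by
      rw [contDiffOn_succ_iff_deriv_of_isOpen isOpen_Ioo]
      refine ⟨fun t ht => (hyd t ht).differentiableAt.differentiableWithinAt, by simp, ?_⟩
      rw [contDiffOn_zero]
      exact h1.congr fun t ht => (hyd t ht).deriv
    simpa using h2

end Group

/-! ### Test functions, translations and weak derivatives -/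

section TestFunction

variable {E : Type*} [NormedAddCommGroup E] [NormedSpace ℝ E]

lemma IsTest.comp_sub {O : Set E} {e : E} (hO : ∀ (t : ℝ), ∀ p ∈ O, p + t • e ∈ O)
    {η : E → ℝ} (h : IsTest O η) (t : ℝ) : IsTest O fun p => η (p - t • e) where
  smooth := h.smooth.comp (by fun_prop)
  compact := h.compact.comp_homeomorph (Homeomorph.subRight (t • e))
  supp := by
    have h1 := tsupport_comp_eq_preimage η (Homeomorph.subRight (t • e))
    intro p hp
    have hp' : p ∈ tsupport (η ∘ Homeomorph.subRight (t • e)) := hp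
    rw [h1] at hp'
    have h2 := hO t _ (h.supp hp')
    simpa using h2

variable [MeasureSpace E]

lemma IsTest.setIntegral_eq {O : Set E} {η : E → ℝ} (hη : IsTest O η) (f : E → ℝ) :
    ∫ p in O, f p * η p = ∫ p, f p * η p := by
  refine setIntegral_eq_integral_of_forall_compl_eq_zero fun x hx => ?_
  rw [image_eq_zero_of_notMem_tsupport fun h => hx (hη.supp h), mul_zero]

lemma IsTest.setIntegral_fderiv_eq {O : Set E} {η : E → ℝ} (hη : IsTest O η) (e : E)
    (f : E → ℝ) : ∫ p in O, f p * fderiv ℝ η p e = ∫ p, f p * fderiv ℝ η p e := by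
  refine setIntegral_eq_integral_of_forall_compl_eq_zero fun x hx => ?_
  have : x ∉ tsupport fun p => fderiv ℝ η p e :=
    fun h => hx (hη.supp (tsupport_fderiv_apply_subset ℝ e h))
  rw [image_eq_zero_of_notMem_tsupport this, mul_zero]

lemma HasWeakDeriv.congr_ae {O : Set E} {e : E} {f g f' g' : E → ℝ} (h : HasWeakDeriv O e f g)
    (hf : f =ᵐ[volume.restrict O] f') (hg : g =ᵐ[volume.restrict O] g') :
    HasWeakDeriv O e f' g' := by
  intro η hη
  have h1 : ∫ p in O, f' p * fderiv ℝ η p e = ∫ p in O, f p * fderiv ℝ η p e :=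
    integral_congr_ae (by filter_upwards [hf] with p hp; rw [hp])
  have h2 : ∫ p in O, g' p * η p = ∫ p in O, g p * η p :=
    integral_congr_ae (by filter_upwards [hg] with p hp; rw [hp])
  rw [h1, h2]
  exact h η hη

end TestFunction

section Translation

variable {E : Type*} [NormedAddCommGroup E] [NormedSpace ℝ E] [MeasureSpace E] [BorelSpace E]
  [FiniteDimensional ℝ E]

/-- An open set that is invariant under translations in the direction `e`, together with a name for
the Lebesgue measure on it. The measure is kept as a parameter so that the whole space
can be equipped with `volume` itself. -/
structure ShiftInvariant (O : Set E) (e : E) (m : Measure E) : Prop where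
  isOpen : IsOpen O
  add_mem : ∀ (t : ℝ), ∀ p ∈ O, p + t • e ∈ O
  measure_eq : m = volume.restrict O

/-- An `L²` function that is orthogonal to all test functions vanishes. -/
lemma eq_zero_of_forall_test {O : Set E} (hO : IsOpen O) {m : Measure E}
    [IsLocallyFiniteMeasure (volume : Measure E)] (hm : m = volume.restrict O) (f : Lp ℝ 2 m)
    (h : ∀ η, IsTest O η → ∫ p, f p * η p ∂m = 0) : f = 0 := by
  subst hm
  have hloc : LocallyIntegrableOn f O volume :=
    locallyIntegrableOn_of_locallyIntegrable_restrict
      ((Lp.memLp f).locallyIntegrable (by norm_num))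
  have h1 := hO.ae_eq_zero_of_integral_contDiff_smul_eq_zero hloc (fun η h1 h2 h3 => by
    rw [← setIntegral_eq_integral_of_forall_compl_eq_zero (s := O), ← h η ⟨h1, h2, h3⟩]
    · simp only [smul_eq_mul, mul_comm]
    · intro x hx
      have : η x = 0 := image_eq_zero_of_notMem_tsupport fun h => hx (h3 h)
      simp [this])
  refine (Lp.eq_zero_iff_ae_eq_zero).2 ?_
  exact (ae_restrict_iff' hO.measurableSet).2 h1

variable [(volume : Measure E).IsAddHaarMeasure]

/-- Integration by parts: partial derivatives of test functions are weak derivatives. -/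
lemma IsTest.integral_mul_fderiv {O : Set E} {f η : E → ℝ} (hf : ContDiff ℝ 1 f)
    (hη : IsTest O η) (e : E) :
    ∫ p, f p * fderiv ℝ η p e = -∫ p, fderiv ℝ f p e * η p := by
  have hη1 : ContDiff ℝ 1 η := hη.smooth.of_le (by simp)
  have c1 : Continuous fun p => fderiv ℝ η p e :=
    (hη1.continuous_fderiv one_ne_zero).clm_apply continuous_const
  have c2 : Continuous fun p => fderiv ℝ f p e :=
    (hf.continuous_fderiv one_ne_zero).clm_apply continuous_const
  refine integral_mul_fderiv_eq_neg_fderiv_mul_of_integrable ?_ ?_ ?_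
    (fun x _ => hf.differentiable one_ne_zero x) (fun x _ => hη1.differentiable one_ne_zero x)
  · exact (c2.mul hη1.continuous).integrable_of_hasCompactSupport hη.compact.mul_left
  · exact (hf.continuous.mul c1).integrable_of_hasCompactSupport
      (hη.compact.fderiv_apply (𝕜 := ℝ) e).mul_left
  · exact (hf.continuous.mul hη1.continuous).integrable_of_hasCompactSupport hη.compact.mul_left

lemma hasWeakDeriv_of_contDiff {O : Set E} {f : E → ℝ} (hf : ContDiff ℝ 1 f) (e : E) :
    HasWeakDeriv O e f fun p => fderiv ℝ f p e := by
  intro η hη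
  rw [hη.setIntegral_fderiv_eq, hη.setIntegral_eq, hη.integral_mul_fderiv hf]

namespace ShiftInvariant

variable {O : Set E} {e : E} {m : Measure E}

lemma measurePreserving (hO : ShiftInvariant O e m) (t : ℝ) :
    MeasurePreserving (fun p : E => p + t • e) m m := by
  have h1 := (measurePreserving_add_right (volume : Measure E) (t • e)).restrict_preimage
    hO.isOpen.measurableSet
  have h2 : (fun p : E => p + t • e) ⁻¹' O = O := by
    ext p
    refine ⟨fun h => ?_, hO.add_mem t p⟩
    have := hO.add_mem (-t) _ h
    simpa using this
  rw [h2] at h1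
  rwa [hO.measure_eq]

/-- Translation in the direction `e` as an operator in `L²`: `(τ_t f)(p) = f(p + t e)`. -/
noncomputable def transl (hO : ShiftInvariant O e m) (t : ℝ) : Lp ℝ 2 m →L[ℝ] Lp ℝ 2 m :=
  (Lp.compMeasurePreservingₗᵢ ℝ (fun p : E => p + t • e)
    (hO.measurePreserving t)).toContinuousLinearMap

lemma coeFn_transl (hO : ShiftInvariant O e m) (t : ℝ) (f : Lp ℝ 2 m) :
    hO.transl t f =ᵐ[m] fun p => f (p + t • e) :=
  Lp.coeFn_compMeasurePreserving f (hO.measurePreserving t)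

lemma transl_zero (hO : ShiftInvariant O e m) (f : Lp ℝ 2 m) : hO.transl 0 f = f := by
  refine Lp.ext ((hO.coeFn_transl 0 f).trans ?_)
  simp

lemma continuous_transl (hO : ShiftInvariant O e m) (f : Lp ℝ 2 m) :
    Continuous fun t => hO.transl t f := by
  have hm := hO.measure_eq
  subst hm
  have hc : Continuous fun t : ℝ => (⟨fun p : E => p + t • e, by fun_prop⟩ : C(E, E)) := by
    refine ContinuousMap.continuous_of_continuous_uncurry _ ?_
    change Continuous fun q : ℝ × E => q.2 + q.1 • e
    fun_prop
  exact (continuous_const (y := f)).compMeasurePreservingLp hc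
    (fun t => hO.measurePreserving t) (by norm_num)

lemma integral_transl_mul (hO : ShiftInvariant O e m) (t : ℝ) (f : Lp ℝ 2 m) (h : E → ℝ) :
    ∫ p, hO.transl t f p * h p ∂m = ∫ p, f p * h (p - t • e) ∂m := by
  rw [← (hO.measurePreserving t).integral_comp
    (Homeomorph.addRight (t • e)).measurableEmbedding (fun p => f p * h (p - t • e))]
  refine integral_congr_ae ?_
  filter_upwards [hO.coeFn_transl t f] with p hp
  rw [hp, add_sub_cancel_right]

lemma inner_transl (hO : ShiftInvariant O e m) (t : ℝ) (f g : Lp ℝ 2 m) :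
    ⟪hO.transl t f, g⟫ = ⟪f, hO.transl (-t) g⟫ := by
  have h1 : ⟪hO.transl t f, g⟫ = ∫ p, hO.transl t f p * g p ∂m := by
    rw [L2.inner_def]
    simp [mul_comm]
  rw [h1, hO.integral_transl_mul, L2.inner_def]
  refine integral_congr_ae ?_
  filter_upwards [hO.coeFn_transl (-t) g] with p hp
  rw [hp]
  simp [sub_eq_add_neg, mul_comm]

/-- Translations commute with weak derivatives. -/
lemma hasWeakDeriv_transl (hO : ShiftInvariant O e m) {e' : E} {f g : Lp ℝ 2 m}
    (h : HasWeakDeriv O e' f g) (t : ℝ) : HasWeakDeriv O e' (hO.transl t f) (hO.transl t g) := by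
  intro η hη
  have h1 := h _ (hη.comp_sub hO.add_mem t)
  rw [← hO.measure_eq] at h1 ⊢
  rw [hO.integral_transl_mul t f, hO.integral_transl_mul t g, ← h1]
  simp only [fderiv_comp_sub]

/-- The pairing of a translate with a test function is differentiable in the translation
parameter; its derivative falls on the test function and is moved back by the definition of weak
derivatives. -/
lemma hasDerivAt_integral_transl_mul (hO : ShiftInvariant O e m) {f g : Lp ℝ 2 m}
    (h : HasWeakDeriv O e f g) {η : E → ℝ} (hη : IsTest O η) (t : ℝ) :
    HasDerivAt (fun t => ∫ p, hO.transl t f p * η p ∂m) (∫ p, hO.transl t g p * η p ∂m) t := by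
  have hm : IsFiniteMeasureOnCompacts m := by
    rw [hO.measure_eq]; infer_instance
  have hval : ∫ p, hO.transl t g p * η p ∂m
      = ∫ p, f p * -(fderiv ℝ η (p - t • e) e) ∂m := by
    have h1 := h _ (hη.comp_sub hO.add_mem t)
    simp only [fderiv_comp_sub] at h1
    rw [← hO.measure_eq] at h1
    rw [hO.integral_transl_mul t g]
    simp only [mul_neg, integral_neg, h1, neg_neg]
  rw [hval]
  simp only [hO.integral_transl_mul]
  have hη1 : ContDiff ℝ 1 η := hη.smooth.of_le (by simp)
  have hdc : Continuous fun p => fderiv ℝ η p e :=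
    (hη1.continuous_fderiv one_ne_zero).clm_apply continuous_const
  obtain ⟨C, hC⟩ := hdc.bounded_above_of_compact_support (hη.compact.fderiv_apply (𝕜 := ℝ) e)
  let K : Set E := (fun q : E × ℝ => q.1 + q.2 • e) '' (tsupport η ×ˢ Icc (t - 1) (t + 1))
  have hK : IsCompact K := (hη.compact.isCompact.prod isCompact_Icc).image (by fun_prop)
  have hKmem : ∀ s ∈ Metric.ball t 1, ∀ p ∉ K, fderiv ℝ η (p - s • e) e = 0 := by
    intro s hs p hp
    have : p - s • e ∉ tsupport fun p => fderiv ℝ η p e := by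
      intro h2
      refine hp ⟨(p - s • e, s), ⟨tsupport_fderiv_apply_subset ℝ e h2, ?_⟩, by simp⟩
      rw [Metric.mem_ball, Real.dist_eq, abs_lt] at hs
      constructor <;> linarith
    exact image_eq_zero_of_notMem_tsupport (f := fun p => fderiv ℝ η p e) this
  have hbd : MemLp (K.indicator fun _ => C) 2 m :=
    memLp_indicator_const 2 hK.measurableSet C (Or.inr hK.measure_lt_top.ne)
  have hfm := Lp.aestronglyMeasurable f
  refine (hasDerivAt_integral_of_dominated_loc_of_deriv_le (𝕜 := ℝ) (s := Metric.ball t 1)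
    (F := fun s p => f p * η (p - s • e)) (F' := fun s p => f p * -(fderiv ℝ η (p - s • e) e))
    (bound := fun p => ‖f p‖ * K.indicator (fun _ => C) p)
    (Metric.ball_mem_nhds t one_pos) ?_ ?_ ?_ ?_ ?_ ?_).2
  · refine Eventually.of_forall fun s => hfm.mul ?_
    exact (hη1.continuous.comp (by fun_prop)).aestronglyMeasurable
  · exact (Lp.memLp f).integrable_mul (hη.comp_sub hO.add_mem t).memLp
  · refine hfm.mul (Continuous.aestronglyMeasurable ?_)
    exact (hdc.comp (by fun_prop : Continuous fun p => p - t • e)).neg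
  · refine Eventually.of_forall fun p s hs => ?_
    rw [norm_mul, norm_neg]
    refine mul_le_mul_of_nonneg_left ?_ (norm_nonneg _)
    by_cases hp : p ∈ K
    · rw [indicator_of_mem hp]; exact hC _
    · rw [indicator_of_notMem hp, hKmem s hs p hp, norm_zero]
  · exact (Lp.memLp f).norm.integrable_mul hbd
  · refine Eventually.of_forall fun p s _ => HasDerivAt.const_mul _ ?_
    have h1 : HasDerivAt (fun s : ℝ => p - s • e) (-e) s := by
      simpa using ((hasDerivAt_id s).smul_const e).const_sub p
    have h2 := (hη1.differentiable one_ne_zero (p - s • e)).hasFDerivAt.comp_hasDerivAt s h1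
    simpa [Function.comp_def] using! h2

lemma transl_eq_add_integral (hO : ShiftInvariant O e m) {f g : Lp ℝ 2 m}
    (h : HasWeakDeriv O e f g) (t : ℝ) :
    hO.transl t f = f + ∫ s in (0 : ℝ)..t, hO.transl s g := by
  have hm : IsFiniteMeasureOnCompacts m := by
    rw [hO.measure_eq]; infer_instance
  rw [← sub_eq_zero]
  refine eq_zero_of_forall_test hO.isOpen hO.measure_eq _ fun η hη => ?_
  obtain ⟨L, hL⟩ := exists_pairing (hη.memLp (m := m))
  have hc := hO.continuous_transl g
  rw [← hL, map_sub, map_add, ← L.intervalIntegral_comp_comm (hc.intervalIntegrable _ _)]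
  have h1 : ∀ s, HasDerivAt (fun s => L (hO.transl s f)) (L (hO.transl s g)) s := by
    intro s
    simp only [hL]
    exact hO.hasDerivAt_integral_transl_mul h hη s
  rw [intervalIntegral.integral_eq_sub_of_hasDerivAt (fun s _ => h1 s)
    ((L.continuous.comp hc).intervalIntegrable _ _), hO.transl_zero]
  ring

/-- A weak derivative in `L²` is the derivative of the group of translations. -/
lemma hasDerivAt_transl (hO : ShiftInvariant O e m) {f g : Lp ℝ 2 m}
    (h : HasWeakDeriv O e f g) : HasDerivAt (fun t => hO.transl t f) g 0 := by
  have h1 := ((hO.continuous_transl g).integral_hasStrictDerivAt 0 0).hasDerivAt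
  rw [hO.transl_zero] at h1
  refine (h1.const_add f).congr_of_eventuallyEq (Eventually.of_forall fun t => ?_)
  exact hO.transl_eq_add_integral h t

/-- Integration by parts in the direction of translation. -/
lemma inner_eq_neg_of_hasDerivAt (hO : ShiftInvariant O e m) {f f' g g' : Lp ℝ 2 m}
    (hf : HasDerivAt (fun t => hO.transl t f) f' 0)
    (hg : HasDerivAt (fun t => hO.transl t g) g' 0) :
    ⟪f', g⟫ = -⟪f, g'⟫ := by
  have h1 : HasDerivAt (fun t => ⟪hO.transl t f, g⟫) ⟪f', g⟫ 0 := by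
    simpa using hf.inner ℝ (hasDerivAt_const (0 : ℝ) g)
  have h2 : HasDerivAt (fun t => hO.transl (-t) g) (-g') 0 := by
    rw [← neg_zero] at hg
    simpa [Function.comp_def] using HasDerivAt.scomp (0 : ℝ) hg (hasDerivAt_neg (0 : ℝ))
  have h3 : HasDerivAt (fun t => ⟪hO.transl t f, g⟫) (-⟪f, g'⟫) 0 := by
    simp only [hO.inner_transl]
    simpa using (hasDerivAt_const (0 : ℝ) f).inner ℝ h2
  exact h1.unique h3

end ShiftInvariant

end Translation

/-! ### Partial derivatives of test functions on the plane -/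

/-- The partial derivative of a function on the plane. -/
noncomputable def pd (i : Fin 2) (f : Plane → ℝ) : Plane → ℝ := fun x => fderiv ℝ f x (planeDir i)

lemma IsTest.partialDeriv {O : Set Plane} {f : Plane → ℝ} (h : IsTest O f) (i : Fin 2) :
    IsTest O (pd i f) where
  smooth := (h.smooth.fderiv_right (m := ∞) (by simp)).clm_apply contDiff_const
  compact := h.compact.fderiv_apply (𝕜 := ℝ) _
  supp := (tsupport_fderiv_apply_subset ℝ _).trans h.supp

lemma pd_comm {f : Plane → ℝ} (h : ContDiff ℝ ∞ f) (i j : Fin 2) :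
    pd i (pd j f) = pd j (pd i f) := by
  have hd : Differentiable ℝ (fderiv ℝ f) :=
    (h.fderiv_right (m := ∞) (by simp)).differentiable (by simp)
  have key : ∀ i j x, pd i (pd j f) x = fderiv ℝ (fderiv ℝ f) x (planeDir i) (planeDir j) := by
    intro i j x
    change fderiv ℝ (fun x => fderiv ℝ f x (planeDir j)) x (planeDir i) = _
    rw [fderiv_clm_apply (hd x) (differentiableAt_const _)]
    simp
  ext x
  rw [key, key]
  have hs : IsSymmSndFDerivAt ℝ f x :=
    h.contDiffAt.isSymmSndFDerivAt (by
      rw [minSmoothness_of_isRCLikeNormedField]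
      exact WithTop.coe_le_coe.2 (le_top (a := (2 : ℕ∞))))
  exact hs _ _

lemma IsTest.integral_mul_pd {O O' : Set Plane} {f g : Plane → ℝ} (hf : IsTest O f)
    (hg : IsTest O' g) (i : Fin 2) : ∫ x, f x * pd i g x = -∫ x, pd i f x * g x :=
  hg.integral_mul_fderiv (hf.smooth.of_le (by simp)) _

lemma IsTest.integrable_mul {O O' : Set Plane} {f g : Plane → ℝ} (hf : IsTest O f)
    (hg : IsTest O' g) : Integrable fun x => f x * g x :=
  (hf.smooth.continuous.mul hg.smooth.continuous).integrable_of_hasCompactSupport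
    hg.compact.mul_left

lemma integral_pd_sq_sum {O : Set Plane} {f : Plane → ℝ} (hf : IsTest O f) :
    ∑ i, ∑ j, ∫ x, pd i (pd j f) x * pd i (pd j f) x
      = ∫ x, (pd 0 (pd 0 f) x + pd 1 (pd 1 f) x) * (pd 0 (pd 0 f) x + pd 1 (pd 1 f) x) := by
  have h1 : ∫ x, pd 0 (pd 0 f) x * pd 1 (pd 1 f) x = ∫ x, pd 0 (pd 1 f) x * pd 0 (pd 1 f) x := by
    have e1 := ((hf.partialDeriv 1).partialDeriv 1).integral_mul_pd (hf.partialDeriv 0) 0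
    have e2 := ((hf.partialDeriv 1).partialDeriv 0).integral_mul_pd (hf.partialDeriv 0) 1
    rw [pd_comm (hf.partialDeriv 1).smooth 0 1] at e1
    rw [pd_comm hf.smooth 1 0] at e2
    have e3 : ∫ x, pd 1 (pd 1 f) x * pd 0 (pd 0 f) x = ∫ x, pd 0 (pd 0 f) x * pd 1 (pd 1 f) x := by
      simp only [mul_comm]
    rw [← e3, e1, ← e2]
  have h2 : pd 1 (pd 0 f) = pd 0 (pd 1 f) := pd_comm hf.smooth 1 0
  have i1 := ((hf.partialDeriv 0).partialDeriv 0).integrable_mul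
    ((hf.partialDeriv 0).partialDeriv 0)
  have i2 := ((hf.partialDeriv 0).partialDeriv 0).integrable_mul
    ((hf.partialDeriv 1).partialDeriv 1)
  have i3 := ((hf.partialDeriv 1).partialDeriv 1).integrable_mul
    ((hf.partialDeriv 1).partialDeriv 1)
  have e : (fun x => (pd 0 (pd 0 f) x + pd 1 (pd 1 f) x) * (pd 0 (pd 0 f) x + pd 1 (pd 1 f) x))
      = fun x => pd 0 (pd 0 f) x * pd 0 (pd 0 f) x + (2 * (pd 0 (pd 0 f) x * pd 1 (pd 1 f) x)
        + pd 1 (pd 1 f) x * pd 1 (pd 1 f) x) := by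
    funext x; ring
  have e' : ∫ x, (pd 0 (pd 0 f) x + pd 1 (pd 1 f) x) * (pd 0 (pd 0 f) x + pd 1 (pd 1 f) x)
      = (∫ x, pd 0 (pd 0 f) x * pd 0 (pd 0 f) x)
        + (2 * (∫ x, pd 0 (pd 0 f) x * pd 1 (pd 1 f) x)
          + ∫ x, pd 1 (pd 1 f) x * pd 1 (pd 1 f) x) := by
    rw [e, ← integral_const_mul, ← integral_add (i2.const_mul 2) i3]
    exact integral_add i1 ((i2.const_mul 2).add i3)
  rw [e', h1]
  simp only [Fin.sum_univ_two, h2]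
  ring

/-- The Poincaré inequality in a strip. -/
lemma integral_mul_self_le {O : Set Plane} {R : ℝ} (hR : ∀ x ∈ O, |x 0| ≤ R) {f : Plane → ℝ}
    (hf : IsTest O f) :
    ∫ x, f x * f x ≤ (4 * R ^ 2) * ∫ x, pd 0 f x * pd 0 f x := by
  have hff : IsTest O fun x => f x * f x :=
    ⟨hf.smooth.mul hf.smooth, hf.compact.mul_left, (tsupport_mul_subset_left).trans hf.supp⟩
  have hcoord : ContDiff ℝ 1 fun x : Plane => x 0 := by fun_prop
  have h1 := hff.integral_mul_fderiv hcoord (planeDir 0)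
  have h2 : ∀ x : Plane, fderiv ℝ (fun x : Plane => x 0) x (planeDir 0) = 1 := by
    intro x
    have : (fun x : Plane => x 0) = (EuclideanSpace.proj (0 : Fin 2) : Plane →L[ℝ] ℝ) := rfl
    rw [this, ContinuousLinearMap.fderiv]
    simp [planeDir]
  have h3 : ∀ x, fderiv ℝ (fun x => f x * f x) x (planeDir 0) = 2 * f x * pd 0 f x := by
    intro x
    have hd := hf.smooth.differentiable (by simp) x
    rw [fderiv_fun_mul hd hd]
    simp only [_root_.add_apply, _root_.smul_apply, smul_eq_mul, pd]
    ring
  simp only [h2, h3, one_mul] at h1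
  have i1 := hf.integrable_mul hf
  have i2 := (hf.partialDeriv 0).integrable_mul (hf.partialDeriv 0)
  have h4 : ∫ x, f x * f x
      ≤ ∫ x, ((1 / 2) * (f x * f x) + (2 * R ^ 2) * (pd 0 f x * pd 0 f x)) := by
    have h5 : ∫ x, f x * f x = ∫ x : Plane, -(x 0 * (2 * f x * pd 0 f x)) := by
      rw [integral_neg, h1, neg_neg]
    rw [h5]
    refine integral_mono ?_ ((i1.const_mul _).add (i2.const_mul _)) fun x => ?_
    · have hc : Continuous fun x : Plane => -(x 0 * (2 * f x * pd 0 f x)) :=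
        ((hcoord.continuous.mul ((continuous_const.mul hf.smooth.continuous).mul
          (hf.partialDeriv 0).smooth.continuous))).neg
      exact hc.integrable_of_hasCompactSupport
        (((hf.partialDeriv 0).compact.mul_left (f := fun x => 2 * f x)).mul_left
          (f := fun x : Plane => x 0)).neg
    · simp only
      by_cases hx : x ∈ tsupport f
      · have h6 : x 0 ^ 2 ≤ R ^ 2 := by
          have := hR x (hf.supp hx)
          rw [← sq_abs (x 0)]
          gcongr
        nlinarith [sq_nonneg (f x + 2 * x 0 * pd 0 f x), mul_nonneg (sub_nonneg.2 h6)
          (sq_nonneg (pd 0 f x))]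
      · rw [image_eq_zero_of_notMem_tsupport hx]
        nlinarith [mul_nonneg (sq_nonneg R) (mul_self_nonneg (pd 0 f x))]
  rw [integral_add (i1.const_mul _) (i2.const_mul _), integral_const_mul, integral_const_mul] at h4
  linarith

/-! ### The space `H²₀(Ω)` -/

section H02

variable {Ω : Set Plane}

lemma isTestJet_iff (p : Jet2 Ω) : IsTestJet Ω p ↔ ∃ η : Plane → ℝ, IsTest Ω η ∧
    p none =ᵐ[volume.restrict Ω] η ∧ (∀ i, p (some (.inl i)) =ᵐ[volume.restrict Ω] pd i η) ∧
    ∀ i j, p (some (.inr (i, j))) =ᵐ[volume.restrict Ω] pd i (pd j η) := Iff.rfl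

lemma pd_add {f g : Plane → ℝ} (hf : ContDiff ℝ ∞ f) (hg : ContDiff ℝ ∞ g) (i : Fin 2) :
    pd i (f + g) = pd i f + pd i g := by
  ext x
  simp [pd, fderiv_add (hf.differentiable (by simp) x) (hg.differentiable (by simp) x)]

lemma pd_smul {f : Plane → ℝ} (c : ℝ) (i : Fin 2) : pd i (c • f) = c • pd i f := by
  ext x
  simp [pd, fderiv_const_smul_field]

lemma IsTest.add {O : Set Plane} {f g : Plane → ℝ} (hf : IsTest O f) (hg : IsTest O g) :
    IsTest O (f + g) :=
  ⟨hf.smooth.add hg.smooth, hf.compact.add hg.compact,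
    (tsupport_add f g).trans (union_subset hf.supp hg.supp)⟩

lemma IsTest.const_smul {O : Set Plane} {f : Plane → ℝ} (hf : IsTest O f) (c : ℝ) :
    IsTest O (c • f) :=
  ⟨hf.smooth.const_smul c, hf.compact.smul_left (f := fun _ => c),
    (tsupport_smul_subset_right (fun _ => c) f).trans hf.supp⟩

lemma isTestJet_of_mem_span {p : Jet2 Ω} (hp : p ∈ Submodule.span ℝ {p | IsTestJet Ω p}) :
    IsTestJet Ω p := by
  induction hp using Submodule.span_induction with
  | mem p hp => exact hp
  | zero =>
    have h0 : ∀ i, pd i (0 : Plane → ℝ) = 0 := by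
      intro i; ext x
      change fderiv ℝ (fun _ : Plane => (0 : ℝ)) x _ = 0
      simp
    refine (isTestJet_iff _).2 ⟨0, ⟨contDiff_const, HasCompactSupport.zero, by simp⟩,
      Lp.coeFn_zero _ _ _, fun i => ?_, fun i j => ?_⟩
    · rw [h0]; exact Lp.coeFn_zero _ _ _
    · rw [h0, h0]; exact Lp.coeFn_zero _ _ _
  | add p q _ _ hp hq =>
    obtain ⟨f, hf, f0, f1, f2⟩ := (isTestJet_iff _).1 hp
    obtain ⟨g, hg, g0, g1, g2⟩ := (isTestJet_iff _).1 hq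
    refine (isTestJet_iff _).2 ⟨f + g, hf.add hg, (Lp.coeFn_add _ _).trans (f0.add g0),
      fun i => ?_, fun i j => ?_⟩
    · rw [pd_add hf.smooth hg.smooth]
      exact (Lp.coeFn_add _ _).trans ((f1 i).add (g1 i))
    · rw [pd_add hf.smooth hg.smooth, pd_add (hf.partialDeriv j).smooth (hg.partialDeriv j).smooth]
      exact (Lp.coeFn_add _ _).trans ((f2 i j).add (g2 i j))
  | smul c p _ hp =>
    obtain ⟨f, hf, f0, f1, f2⟩ := (isTestJet_iff _).1 hp
    refine (isTestJet_iff _).2 ⟨c • f, hf.const_smul c,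
      (Lp.coeFn_smul _ _).trans (f0.const_smul c), fun i => ?_, fun i j => ?_⟩
    · rw [pd_smul]
      exact (Lp.coeFn_smul _ _).trans ((f1 i).const_smul c)
    · rw [pd_smul, pd_smul]
      exact (Lp.coeFn_smul _ _).trans ((f2 i j).const_smul c)

/-- A closed property of jets that holds for test functions holds in `H²₀(Ω)`. -/
lemma H02.induction {P : Jet2 Ω → Prop} (hcl : IsClosed {p | P p})
    (h : ∀ p, IsTestJet Ω p → P p) (u : H02 Ω) : P (H02.jet Ω u) := by
  have h1 : closure (Submodule.span ℝ {p | IsTestJet Ω p} : Set (Jet2 Ω)) ⊆ {p | P p} :=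
    closure_minimal (fun p hp => h p (isTestJet_of_mem_span hp)) hcl
  exact h1 u.2

/-- A test function as an element of `H²₀(Ω)`. -/
lemma H02.exists_of_isTest {η : Plane → ℝ} (hη : IsTest Ω η) :
    ∃ u : H02 Ω, H02.val Ω u =ᵐ[volume.restrict Ω] η := by
  let p : Jet2 Ω := WithLp.toLp 2 fun o => match o with
    | none => (hη.memLp (m := volume.restrict Ω)).toLp
    | some (.inl i) => ((hη.partialDeriv i).memLp (m := volume.restrict Ω)).toLp
    | some (.inr (i, j)) =>
      (((hη.partialDeriv j).partialDeriv i).memLp (m := volume.restrict Ω)).toLp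
  have hp : IsTestJet Ω p := (isTestJet_iff p).2 ⟨η, hη, hη.memLp.coeFn_toLp,
    fun i => (hη.partialDeriv i).memLp.coeFn_toLp,
    fun i j => ((hη.partialDeriv j).partialDeriv i).memLp.coeFn_toLp⟩
  exact ⟨⟨p, subset_closure (Submodule.subset_span hp)⟩, hη.memLp.coeFn_toLp⟩

/-- Integration by parts in `H²₀(Ω)` against functions that need not vanish near `∂Ω`. -/
lemma H02.integral_mul_fderiv {a b : Option (Fin 2 ⊕ Fin 2 × Fin 2)} {i : Fin 2}
    (hab : ∀ p, IsTestJet Ω p → ∃ f, IsTest Ω f ∧ p a =ᵐ[volume.restrict Ω] f ∧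
      p b =ᵐ[volume.restrict Ω] pd i f)
    (u : H02 Ω) {η : Plane → ℝ} (hη : IsTest univ η) :
    ∫ x in Ω, H02.jet Ω u a x * pd i η x = -∫ x in Ω, H02.jet Ω u b x * η x := by
  obtain ⟨L1, hL1⟩ := exists_pairing ((hη.partialDeriv i).memLp (m := volume.restrict Ω))
  obtain ⟨L2, hL2⟩ := exists_pairing (hη.memLp (m := volume.restrict Ω))
  rw [← hL1, ← hL2]
  refine H02.induction (P := fun p => L1 (p a) = -L2 (p b)) ?_ (fun p hp => ?_) u
  · exact isClosed_eq (by fun_prop) (by fun_prop)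
  · obtain ⟨f, hf, h1, h2⟩ := hab p hp
    rw [hL1, hL2]
    have e1 : ∫ x in Ω, p a x * pd i η x = ∫ x in Ω, pd i η x * f x :=
      integral_congr_ae (by filter_upwards [h1] with x hx; rw [hx, mul_comm])
    have e2 : ∫ x in Ω, p b x * η x = ∫ x in Ω, η x * pd i f x :=
      integral_congr_ae (by filter_upwards [h2] with x hx; rw [hx, mul_comm])
    rw [e1, e2, hf.setIntegral_eq, (hf.partialDeriv i).setIntegral_eq,
      hη.integral_mul_pd hf, neg_neg]

lemma H02.integral_val_mul (u : H02 Ω) (i : Fin 2) {η : Plane → ℝ} (hη : IsTest univ η) :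
    ∫ x in Ω, H02.val Ω u x * pd i η x = -∫ x in Ω, H02.d Ω i u x * η x := by
  refine H02.integral_mul_fderiv (a := none) (b := some (.inl i)) (fun p hp => ?_) u hη
  obtain ⟨f, hf, f0, f1, f2⟩ := (isTestJet_iff _).1 hp
  exact ⟨f, hf, f0, f1 i⟩

lemma H02.integral_d_mul (u : H02 Ω) (i j : Fin 2) {η : Plane → ℝ} (hη : IsTest univ η) :
    ∫ x in Ω, H02.d Ω j u x * pd i η x = -∫ x in Ω, H02.dd Ω i j u x * η x := by
  refine H02.integral_mul_fderiv (a := some (.inl j)) (b := some (.inr (i, j)))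
    (fun p hp => ?_) u hη
  obtain ⟨f, hf, f0, f1, f2⟩ := (isTestJet_iff _).1 hp
  exact ⟨pd j f, hf.partialDeriv j, f1 j, f2 i j⟩

/-- The inclusion of `H²₀(Ω)` into `L²(Ω)` is injective. -/
lemma H02.eq_zero_of_val_eq_zero (hΩ : IsOpen Ω) {u : H02 Ω} (h : H02.val Ω u = 0) : u = 0 := by
  have hz : ∀ (f : L2On Ω), f = 0 → ∀ g : Plane → ℝ, ∫ x in Ω, f x * g x = 0 := by
    rintro f rfl g
    rw [integral_congr_ae (g := fun _ => (0 : ℝ)), integral_zero]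
    filter_upwards [Lp.coeFn_zero ℝ 2 ((volume : Measure Plane).restrict Ω)] with x hx
    rw [hx, Pi.zero_apply, zero_mul]
  have huniv : ∀ {η : Plane → ℝ}, IsTest Ω η → IsTest univ η := fun hη =>
    ⟨hη.smooth, hη.compact, subset_univ _⟩
  have hd : ∀ i, H02.d Ω i u = 0 := fun i =>
    eq_zero_of_forall_test hΩ rfl _ fun η hη => by
      rw [← neg_eq_zero, ← H02.integral_val_mul u i (huniv hη), hz _ h]
  have hdd : ∀ i j, H02.dd Ω i j u = 0 := fun i j =>
    eq_zero_of_forall_test hΩ rfl _ fun η hη => by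
      rw [← neg_eq_zero, ← H02.integral_d_mul u i j (huniv hη), hz _ (hd j)]
  refine Subtype.ext (PiLp.ext fun o => ?_)
  match o with
  | none => exact h
  | some (.inl i) => exact hd i
  | some (.inr (i, j)) => exact hdd i j

lemma eq_zero_of_inner_val_H02 (hΩ : IsOpen Ω) {f : L2On Ω}
    (h : ∀ w : H02 Ω, ⟪f, H02.val Ω w⟫ = 0) : f = 0 := by
  refine eq_zero_of_forall_test hΩ rfl f fun η hη => ?_
  obtain ⟨u, hu⟩ := H02.exists_of_isTest hη
  rw [← h u, L2.inner_def]
  refine integral_congr_ae ?_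
  filter_upwards [hu] with x hx
  simp [hx, mul_comm]

lemma norm_sq_eq_of_ae {f : L2On Ω} {g : Plane → ℝ} (hg : IsTest Ω g)
    (h : f =ᵐ[volume.restrict Ω] g) : ‖f‖ ^ 2 = ∫ x, g x * g x := by
  rw [← real_inner_self_eq_norm_sq, L2.inner_def, ← hg.setIntegral_eq]
  refine integral_congr_ae ?_
  filter_upwards [h] with x hx
  simp [hx, sq]

/-- On a bounded set the norm of `H²₀(Ω)` is controlled by the norm of the Laplacian in `L²`. -/
lemma H02.exists_norm_sq_le (hΩb : Bornology.IsBounded Ω) :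
    ∃ C : ℝ, 0 < C ∧ ∀ u : H02 Ω, ‖u‖ ^ 2 ≤ C * ‖H02.lap Ω u‖ ^ 2 := by
  obtain ⟨R, hR⟩ := hΩb.exists_norm_le
  have hR' : ∀ x ∈ Ω, |x 0| ≤ R := fun x hx =>
    (PiLp.norm_apply_le x 0).trans (hR x hx)
  set K := 4 * R ^ 2
  have hK : 0 ≤ K := by positivity
  refine ⟨K ^ 2 + K + 1, by positivity, fun u => ?_⟩
  refine H02.induction (P := fun p => ‖p‖ ^ 2
    ≤ (K ^ 2 + K + 1) * ‖p (some (.inr (0, 0))) + p (some (.inr (1, 1)))‖ ^ 2) ?_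
    (fun p hp => ?_) u
  · exact isClosed_le (by fun_prop) (by fun_prop)
  · obtain ⟨f, hf, f0, f1, f2⟩ := (isTestJet_iff _).1 hp
    have e0 := norm_sq_eq_of_ae hf f0
    have e1 := fun i => norm_sq_eq_of_ae (hf.partialDeriv i) (f1 i)
    have e2 := fun i j => norm_sq_eq_of_ae ((hf.partialDeriv j).partialDeriv i) (f2 i j)
    have e3 := norm_sq_eq_of_ae (((hf.partialDeriv 0).partialDeriv 0).add
      ((hf.partialDeriv 1).partialDeriv 1))
      ((Lp.coeFn_add _ _).trans ((f2 0 0).add (f2 1 1)))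
    simp only [Pi.add_apply] at e3
    rw [← integral_pd_sq_sum hf] at e3
    have p0 := integral_mul_self_le hR' hf
    have p1 := fun i => integral_mul_self_le hR' (hf.partialDeriv i)
    have p10 := p1 0
    have p11 := p1 1
    rw [PiLp.norm_sq_eq_of_L2]
    simp only [Fintype.sum_option, Fintype.sum_sum_type, Fintype.sum_prod_type, e0, e1, e2]
    rw [e3]
    have hn : ∀ i j, 0 ≤ ∫ x, pd i (pd j f) x * pd i (pd j f) x := fun i j =>
      integral_nonneg fun x => mul_self_nonneg _
    have n01 := hn 0 1
    have n10 := hn 1 0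
    have n00 := hn 0 0
    have n11 := hn 1 1
    simp only [Fin.sum_univ_two]
    generalize (∫ x, pd 0 (pd 0 f) x * pd 0 (pd 0 f) x) = a00 at *
    generalize (∫ x, pd 0 (pd 1 f) x * pd 0 (pd 1 f) x) = a01 at *
    generalize (∫ x, pd 1 (pd 0 f) x * pd 1 (pd 0 f) x) = a10 at *
    generalize (∫ x, pd 1 (pd 1 f) x * pd 1 (pd 1 f) x) = a11 at *
    generalize (∫ x, pd 0 f x * pd 0 f x) = b0 at *
    generalize (∫ x, pd 1 f x * pd 1 f x) = b1 at *
    generalize (∫ x, f x * f x) = c0 at *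
    have q : K * b0 ≤ K ^ 2 * a00 := by nlinarith
    have q' : 0 ≤ (K ^ 2) * (a01 + a10 + a11) := by positivity
    have q'' : 0 ≤ K * (a10 + a11) := by positivity
    linarith

end H02

lemma isCoercive_energyInner {Ω : Set Plane} (hΩb : Bornology.IsBounded Ω) {μ : ℝ} (hμ : 0 < μ) :
    IsCoercive (energyInner Ω μ) := by
  obtain ⟨c, hc, h1⟩ := isCoercive_opA hμ
  obtain ⟨C, hC, h2⟩ := H02.exists_norm_sq_le hΩb
  refine ⟨min (min c C⁻¹) 1, by positivity, fun y => ?_⟩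
  have e := energyInner_apply Ω μ y y
  simp only [real_inner_self_eq_norm_sq] at e
  have a1 := h1 (Y.phi y)
  have a2 := h2 (Y.u y)
  have a3 := sq_nonneg ‖Y.psi y‖
  have a4 := sq_nonneg ‖Y.v y‖
  have a5 := sq_nonneg ‖H02.lap Ω (Y.u y)‖
  have a6 : 0 ≤ c * ‖Y.phi y‖ * ‖Y.phi y‖ := by positivity
  have a7 : C⁻¹ * ‖Y.u y‖ ^ 2 ≤ ‖H02.lap Ω (Y.u y)‖ ^ 2 := by
    rwa [inv_mul_le_iff₀ hC]
  set k := min (min c C⁻¹) 1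
  have k1 : k ≤ c := (min_le_left _ _).trans (min_le_left _ _)
  have k2 : k ≤ C⁻¹ := (min_le_left _ _).trans (min_le_right _ _)
  have k3 : k ≤ 1 := min_le_right _ _
  have hn : ‖y‖ = max ‖Y.phi y‖ (max ‖Y.psi y‖ (max ‖Y.u y‖ ‖Y.v y‖)) := rfl
  have b1 := mul_le_mul_of_nonneg_right k1 (sq_nonneg ‖Y.phi y‖)
  have b2 := mul_le_mul_of_nonneg_right k3 (sq_nonneg ‖Y.psi y‖)
  have b3 := mul_le_mul_of_nonneg_right k2 (sq_nonneg ‖Y.u y‖)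
  have b4 := mul_le_mul_of_nonneg_right k3 (sq_nonneg ‖Y.v y‖)
  rw [e, mul_assoc, ← sq, hn]
  rw [mul_assoc, ← sq] at a1 a6
  rcases max_choice ‖Y.phi y‖ (max ‖Y.psi y‖ (max ‖Y.u y‖ ‖Y.v y‖)) with h | h
  · rw [h]; linarith
  · rw [h]
    rcases max_choice ‖Y.psi y‖ (max ‖Y.u y‖ ‖Y.v y‖) with h | h
    · rw [h]; linarith
    · rw [h]
      rcases max_choice ‖Y.u y‖ ‖Y.v y‖ with h | h <;> rw [h] <;> linarith

/-! ### Translations along the flow in `H¹` of the half-space -/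

instance : (volume : Measure Space).IsAddHaarMeasure := by
  rw [Measure.volume_eq_prod]; infer_instance

lemma shiftInvariant_halfSpace :
    ShiftInvariant halfSpace (spaceDir 0) ((volume : Measure Space).restrict halfSpace) where
  isOpen := isOpen_lt continuous_const continuous_snd
  add_mem t p hp := by
    have : (p + t • spaceDir 0).2 = p.2 := by simp [spaceDir]
    change 0 < (p + t • spaceDir 0).2
    rw [this]
    exact hp
  measure_eq := rfl

lemma shiftInvariant_plane : ShiftInvariant univ (planeDir 0) (volume : Measure Plane) where
  isOpen := isOpen_univ
  add_mem _ _ _ := mem_univ _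
  measure_eq := Measure.restrict_univ.symm

/-- Translation in `L²` of the half-space by `t` in the direction of the flow. -/
noncomputable abbrev translHalf (t : ℝ) : L2Half →L[ℝ] L2Half := shiftInvariant_halfSpace.transl t

/-- Translation in `L²` of the plane by `t` in the direction of the flow. -/
noncomputable abbrev translPlane (t : ℝ) : L2Plane →L[ℝ] L2Plane := shiftInvariant_plane.transl t

lemma H1.hasWeakDeriv (φ : H1) (i : Fin 3) :
    HasWeakDeriv halfSpace (spaceDir i) (H1.val φ) (H1.d i φ) := φ.2 i

lemma H1.hasDerivAt_transl (φ : H1) :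
    HasDerivAt (fun t => translHalf t (H1.val φ)) (H1.d 0 φ) 0 :=
  shiftInvariant_halfSpace.hasDerivAt_transl (φ.hasWeakDeriv 0)

lemma H1.inner_d_zero (φ w : H1) : ⟪H1.d 0 φ, H1.val w⟫ = -⟪H1.val φ, H1.d 0 w⟫ :=
  shiftInvariant_halfSpace.inner_eq_neg_of_hasDerivAt φ.hasDerivAt_transl w.hasDerivAt_transl

/-- Translation in `H¹` by `t` in the direction of the flow. -/
noncomputable def H1.shift (t : ℝ) (φ : H1) : H1 :=
  ⟨WithLp.toLp 2 fun o => translHalf t (H1.jet φ o),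
    fun i => shiftInvariant_halfSpace.hasWeakDeriv_transl (φ.hasWeakDeriv i) t⟩

lemma H1.val_shift (t : ℝ) (φ : H1) : H1.val (H1.shift t φ) = translHalf t (H1.val φ) := rfl

lemma H1.d_shift (i : Fin 3) (t : ℝ) (φ : H1) :
    H1.d i (H1.shift t φ) = translHalf t (H1.d i φ) := rfl

/-- The inclusion of `H¹` into `L²` is injective: the weak derivatives are determined by the
function. -/
lemma H1.eq_of_val_eq {φ w : H1} (h : H1.val φ = H1.val w) : φ = w := by
  have hd : ∀ i, H1.d i (φ - w) = 0 := fun i =>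
    eq_zero_of_forall_test shiftInvariant_halfSpace.isOpen rfl _ fun η hη => by
      have h1 := (φ - w).hasWeakDeriv i η hη
      have h2 : H1.val (φ - w) = 0 := by rw [map_sub, h, sub_self]
      rw [h2, integral_congr_ae (g := fun _ => (0 : ℝ)), integral_zero] at h1
      · exact neg_eq_zero.1 h1.symm
      · filter_upwards [Lp.coeFn_zero ℝ 2 ((volume : Measure Space).restrict halfSpace)]
          with x hx
        rw [hx, Pi.zero_apply, zero_mul]
  rw [← sub_eq_zero]
  refine Subtype.ext (PiLp.ext fun o => ?_)
  match o with
  | none => exact (map_sub H1.val φ w).trans (sub_eq_zero.2 h)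
  | some i => exact hd i

lemma eq_zero_of_inner_val_H1 {f : L2Half} (h : ∀ w : H1, ⟪f, H1.val w⟫ = 0) : f = 0 := by
  refine eq_zero_of_forall_test shiftInvariant_halfSpace.isOpen rfl f fun η hη => ?_
  have hη1 : ContDiff ℝ 1 η := hη.smooth.of_le (by simp)
  let w : H1 := ⟨WithLp.toLp 2 fun o => match o with
    | none => (hη.memLp (m := (volume : Measure Space).restrict halfSpace)).toLp
    | some i => (hη.memLp_fderiv (m := (volume : Measure Space).restrict halfSpace)
        (spaceDir i)).toLp, fun i =>
    (hasWeakDeriv_of_contDiff hη1 (spaceDir i)).congr_ae hη.memLp.coeFn_toLp.symm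
      (hη.memLp_fderiv (spaceDir i)).coeFn_toLp.symm⟩
  have hw : H1.val w =ᵐ[(volume : Measure Space).restrict halfSpace] η := hη.memLp.coeFn_toLp
  rw [← h w, L2.inner_def]
  refine integral_congr_ae ?_
  filter_upwards [hw] with x hx
  simp [hx, mul_comm]

/-! ### Translations, the trace and the Neumann problem -/

lemma expExt_transl (t : ℝ) (g : L2Plane) :
    expExt (translPlane t g) = translHalf t (expExt g) := by
  have hq : Measure.QuasiMeasurePreserving (Prod.fst : Space → Plane)
      ((volume : Measure Space).restrict halfSpace) volume := by
    rw [restrict_halfSpace]; exact Measure.quasiMeasurePreserving_fst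
  refine Lp.ext ?_
  filter_upwards [(memLp_expExt (translPlane t g)).coeFn_toLp,
    shiftInvariant_halfSpace.coeFn_transl t (expExt g),
    hq.ae (shiftInvariant_plane.coeFn_transl t g),
    (shiftInvariant_halfSpace.measurePreserving t).quasiMeasurePreserving.ae
      (memLp_expExt g).coeFn_toLp] with p h1 h2 h3 h4
  change (memLp_expExt (translPlane t g)).toLp _ p = _
  rw [h1, h2]
  change _ = (memLp_expExt g).toLp _ (p + t • spaceDir 0)
  rw [h4, h3]
  simp [spaceDir]

lemma trace_shift (t : ℝ) (φ : H1) : trace (H1.shift t φ) = translPlane t (trace φ) := by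
  refine ext_inner_left ℝ fun g => ?_
  have h1 : ⟪g, trace (H1.shift t φ)⟫
      = ⟪expExt g, translHalf t (H1.val φ - H1.d 2 φ)⟫ := by
    rw [trace, ContinuousLinearMap.comp_apply, ContinuousLinearMap.adjoint_inner_right,
      map_sub]
    rfl
  have h2 : ⟪translPlane (-t) g, trace φ⟫
      = ⟪expExt (translPlane (-t) g), H1.val φ - H1.d 2 φ⟫ := by
    rw [trace, ContinuousLinearMap.comp_apply, ContinuousLinearMap.adjoint_inner_right]
    rfl
  rw [h1, real_inner_comm, shiftInvariant_halfSpace.inner_transl, ← expExt_transl,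
    real_inner_comm, ← h2, shiftInvariant_plane.inner_transl, neg_neg]

lemma opA_comm (μ : ℝ) (φ w : H1) : opA μ φ w = opA μ w φ := by
  simp only [opA_apply, real_inner_comm]

lemma opA_shift (μ t : ℝ) (φ w : H1) : opA μ (H1.shift t φ) w = opA μ φ (H1.shift (-t) w) := by
  simp only [opA_apply, H1.val_shift, H1.d_shift, shiftInvariant_halfSpace.inner_transl]

section Solve

variable {V X : Type*} [NormedAddCommGroup V] [InnerProductSpace ℝ V] [CompleteSpace V]
  [NormedAddCommGroup X] [InnerProductSpace ℝ X] [CompleteSpace X] {a : V →L[ℝ] V →L[ℝ] ℝ}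

/-- The solution operator of the variational problem `a(φ, w) = (f, J w)` for all `w`. -/
noncomputable def solve (ha : IsCoercive a) (J : V →L[ℝ] X) : X →L[ℝ] V :=
  (ha.continuousLinearEquivOfBilin.symm : V →L[ℝ] V) ∘L ContinuousLinearMap.adjoint J

lemma form_solve (ha : IsCoercive a) (J : V →L[ℝ] X) (f : X) (w : V) :
    a (solve ha J f) w = ⟪f, J w⟫ := by
  rw [← ha.continuousLinearEquivOfBilin_apply]
  simp [solve, ContinuousLinearMap.adjoint_inner_left]

end Solve

section SolveShift

variable {X : Type*} [NormedAddCommGroup X] [InnerProductSpace ℝ X] [CompleteSpace X]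

/-- Solutions of translation invariant variational problems are as regular in the direction of
the flow as the data. -/
lemma hasDerivAt_shift_solve {μ : ℝ} (hμ : 0 < μ) {J : H1 →L[ℝ] X} {τ : ℝ → X →L[ℝ] X}
    (hτ : ∀ t f g, ⟪τ t f, g⟫ = ⟪f, τ (-t) g⟫) (hJ : ∀ t φ, J (H1.shift t φ) = τ t (J φ))
    {f f' : X} (h : HasDerivAt (fun t => τ t f) f' 0) :
    HasDerivAt (fun t => H1.shift t (solve (isCoercive_opA hμ) J f))
      (solve (isCoercive_opA hμ) J f') 0 := by
  have h1 : ∀ t, H1.shift t (solve (isCoercive_opA hμ) J f)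
      = solve (isCoercive_opA hμ) J (τ t f) := by
    intro t
    refine (isCoercive_opA hμ).eq_of_forall fun w => ?_
    rw [opA_shift, form_solve, form_solve, hJ, hτ]
  simp only [h1]
  exact (solve (isCoercive_opA hμ) J).hasFDerivAt.comp_hasDerivAt (0 : ℝ) h

end SolveShift

lemma d_zero_eq_of_hasDerivAt {φ κ : H1} (h : HasDerivAt (fun t => H1.shift t φ) κ 0) :
    H1.d 0 φ = H1.val κ :=
  φ.hasDerivAt_transl.unique (H1.val.hasFDerivAt.comp_hasDerivAt (0 : ℝ) h)

section Plate

variable {Ω : Set Plane}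

lemma inner_zeroExt_right (f : L2Plane) (g : L2On Ω) : ⟪f, zeroExt Ω g⟫ = ⟪restr Ω f, g⟫ :=
  ContinuousLinearMap.adjoint_inner_right _ _ _

lemma integral_zeroExt_mul (f : L2On Ω) {h : Plane → ℝ} (hh : MemLp h 2 volume) :
    ∫ x, zeroExt Ω f x * h x = ∫ x in Ω, f x * h x := by
  have h1 := inner_zeroExt Ω f (hh.toLp h)
  rw [L2.inner_def, L2.inner_def] at h1
  have e1 : ∫ x, ⟪zeroExt Ω f x, hh.toLp h x⟫ = ∫ x, zeroExt Ω f x * h x := by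
    refine integral_congr_ae ?_
    filter_upwards [hh.coeFn_toLp] with x hx
    simp [hx, mul_comm]
  have e2 : ∫ x in Ω, ⟪f x, restr Ω (hh.toLp h) x⟫ = ∫ x in Ω, f x * h x := by
    refine integral_congr_ae ?_
    filter_upwards [LpToLpRestrictCLM_coeFn ℝ Ω (hh.toLp h), ae_restrict_of_ae hh.coeFn_toLp]
      with x hx hx'
    change ⟪f x, LpToLpRestrictCLM Plane ℝ ℝ volume 2 Ω (hh.toLp h) x⟫ = _
    rw [hx, hx']
    simp [mul_comm]
  rw [← e1, h1, e2]

/-- The extension by zero of a function in `H²₀(Ω)` has a weak derivative on the whole plane. -/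
lemma H02.hasDerivAt_transl (u : H02 Ω) :
    HasDerivAt (fun t => translPlane t (zeroExt Ω (H02.val Ω u))) (zeroExt Ω (H02.d Ω 0 u)) 0 := by
  refine shiftInvariant_plane.hasDerivAt_transl fun η hη => ?_
  rw [setIntegral_univ, setIntegral_univ, integral_zeroExt_mul _ hη.memLp,
    integral_zeroExt_mul _ (hη.memLp_fderiv (planeDir 0)), ← H02.integral_val_mul u 0 hη]
  rfl

lemma inner_restr_trace_of_hasDerivAt {φ κ : H1} (h : HasDerivAt (fun t => H1.shift t φ) κ 0)
    (w : H02 Ω) :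
    ⟪restr Ω (trace κ), H02.val Ω w⟫ = -⟪restr Ω (trace φ), H02.d Ω 0 w⟫ := by
  have h1 : HasDerivAt (fun t => translPlane t (trace φ)) (trace κ) 0 := by
    simpa [Function.comp_def, trace_shift] using
      trace.hasFDerivAt.comp_hasDerivAt (0 : ℝ) h
  have h2 := shiftInvariant_plane.inner_eq_neg_of_hasDerivAt h1 w.hasDerivAt_transl
  rwa [inner_zeroExt_right, inner_zeroExt_right] at h2

/-! ### Skew-symmetry -/

variable {U μ : ℝ} {hμ : 0 < μ}

/-- The pairing of the second component of `𝔸 y` with `∂_x φ`, which is only in `L²`, hence not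
admissible in the weak form of the equation. The identity is the derivative at `t = 0` of the weak
form tested with the difference `φ(· + t) - φ(· - t)`, for which the terms quadratic in `φ` vanish
by antisymmetry. -/
lemma IsValue.inner_psi_d {y z : Y Ω} (h : IsValue Ω U hμ y z) :
    ⟪Y.psi z, H1.d 0 (Y.phi y)⟫ = -U * ⟪H1.d 0 (Y.phi z), H1.d 0 (Y.phi y)⟫
      + ⟪zeroExt Ω (H02.d Ω 0 (Y.u z)), trace (Y.phi y)⟫ := by
  set φ := Y.phi y
  set k := Y.phi z
  set v := zeroExt Ω (Y.v y)
  have hψ : Y.psi y = U • H1.d 0 φ + H1.val k := by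
    rw [h.phi_eq]; module
  have hneg : ∀ {X : Type} [NormedAddCommGroup X] [NormedSpace ℝ X] {q : ℝ → X} {q' : X},
      HasDerivAt q q' 0 → HasDerivAt (fun t => q (-t)) (-q') 0 := by
    intro X _ _ q q' hq
    rw [← neg_zero] at hq
    simpa [Function.comp_def] using! HasDerivAt.scomp (0 : ℝ) hq (hasDerivAt_neg (0 : ℝ))
  have hid : ∀ t, ⟪Y.psi z, translHalf t (H1.val φ) - translHalf (-t) (H1.val φ)⟫
      = U * ⟪translHalf (-t) (H1.val k) - translHalf t (H1.val k), H1.d 0 φ⟫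
        - ⟪translPlane (-t) v - translPlane t v, trace φ⟫ := by
    intro t
    have h1 := h.psi_eq (H1.shift t φ - H1.shift (-t) φ)
    rw [map_add, _root_.add_apply, opA_neumannMap] at h1
    simp only [map_sub, H1.val_shift, H1.d_shift, trace_shift] at h1
    change _ = U * _ - (opA μ φ (H1.shift t φ) - opA μ φ (H1.shift (-t) φ)
      + ⟪v, translPlane t (trace φ) - translPlane (-t) (trace φ)⟫) at h1
    have h2 : opA μ φ (H1.shift t φ) = opA μ φ (H1.shift (-t) φ) := by
      rw [opA_comm, opA_shift]
    have h3 : ⟪H1.d 0 φ, translHalf t (H1.d 0 φ)⟫ = ⟪H1.d 0 φ, translHalf (-t) (H1.d 0 φ)⟫ := by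
      rw [real_inner_comm, shiftInvariant_halfSpace.inner_transl]
    have h4 : ∀ t, ⟪H1.val k, translHalf t (H1.d 0 φ)⟫
        = ⟪translHalf (-t) (H1.val k), H1.d 0 φ⟫ := by
      intro t
      rw [shiftInvariant_halfSpace.inner_transl, neg_neg]
    have h5 : ∀ t, ⟪v, translPlane t (trace φ)⟫ = ⟪translPlane (-t) v, trace φ⟫ := by
      intro t
      rw [shiftInvariant_plane.inner_transl, neg_neg]
    rw [h1, hψ]
    simp only [inner_sub_right, inner_sub_left, inner_add_left, real_inner_smul_left, h2, h3, h4,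
      h5, neg_neg]
    ring
  have d1 : HasDerivAt (fun t => ⟪Y.psi z, translHalf t (H1.val φ) - translHalf (-t) (H1.val φ)⟫)
      ⟪Y.psi z, H1.d 0 φ - -H1.d 0 φ⟫ 0 := by
    simpa using (hasDerivAt_const (0 : ℝ) (Y.psi z)).inner ℝ
      (φ.hasDerivAt_transl.sub (hneg φ.hasDerivAt_transl))
  have hv : HasDerivAt (fun t => translPlane t v) (zeroExt Ω (H02.d Ω 0 (Y.u z))) 0 := by
    have := (Y.u z).hasDerivAt_transl
    rwa [h.u_eq] at this
  have d2 := (((hneg k.hasDerivAt_transl).sub k.hasDerivAt_transl).inner ℝ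
    (hasDerivAt_const (0 : ℝ) (H1.d 0 φ))).const_mul U
  have d3 := ((hneg hv).sub hv).inner ℝ (hasDerivAt_const (0 : ℝ) (trace φ))
  have d4 := d2.sub d3
  have h6 := d1.unique (d4.congr_of_eventuallyEq (Eventually.of_forall hid))
  simp only [inner_zero_right, zero_add, inner_sub_left, inner_sub_right, inner_neg_left,
    inner_neg_right] at h6
  linarith

/-- The energy balance `(y, 𝔸 y)_Y = 0`. -/
lemma IsValue.energyInner_eq_zero {y z : Y Ω} (h : IsValue Ω U hμ y z) :
    energyInner Ω μ y z = 0 := by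
  have h1 := h.inner_psi_d
  have h2 := h.psi_eq (Y.phi z)
  have h3 := h.v_eq (Y.u z)
  have hψ : Y.psi y = U • H1.d 0 (Y.phi y) + H1.val (Y.phi z) := by
    rw [h.phi_eq]; module
  have h4 := H1.inner_d_zero (Y.phi z) (Y.phi z)
  rw [real_inner_comm] at h4
  have h7 : ⟪H1.val (Y.phi z), H1.d 0 (Y.phi z)⟫ = 0 := by linarith
  rw [map_add, _root_.add_apply, opA_neumannMap, inner_zeroExt] at h2
  rw [psiTrace_apply, h.u_eq] at h3
  simp only at h3
  rw [inner_zeroExt] at h1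
  have h5 : ⟪Y.psi z, Y.psi y⟫ = U * ⟪Y.psi z, H1.d 0 (Y.phi y)⟫ + ⟪Y.psi z, H1.val (Y.phi z)⟫ := by
    rw [hψ, inner_add_right, real_inner_smul_right]
  have h6 : ⟪Y.psi y, H1.d 0 (Y.phi z)⟫ = U * ⟪H1.d 0 (Y.phi z), H1.d 0 (Y.phi y)⟫
      + ⟪H1.val (Y.phi z), H1.d 0 (Y.phi z)⟫ := by
    rw [hψ, inner_add_left, real_inner_smul_left, real_inner_comm (H1.d 0 (Y.phi y))]
  have c1 := real_inner_comm (Y.psi z) (Y.psi y)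
  have c2 := real_inner_comm (Y.v z) (Y.v y)
  have c3 := real_inner_comm (Y.v y) (restr Ω (trace (Y.phi z)))
  have c4 := real_inner_comm (H02.d Ω 0 (Y.u z)) (restr Ω (trace (Y.phi y)))
  rw [energyInner_apply]
  linear_combination c1 + h5 + U * h1 + h2 + U * h6 + U * h7 + c2 + h3 + c3 - U * c4

lemma energyInner_skew {p h : Y Ω × Y Ω} (hp : p ∈ bbA Ω U hμ) (hh : h ∈ bbA Ω U hμ) :
    energyInner Ω μ p.1 h.2 = energyInner Ω μ (-p.2) h.1 := by
  have h1 := IsValue.energyInner_eq_zero ((bbA Ω U hμ).add_mem hp hh)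
  have h2 := IsValue.energyInner_eq_zero (show IsValue Ω U hμ p.1 p.2 from hp)
  have h3 := IsValue.energyInner_eq_zero (show IsValue Ω U hμ h.1 h.2 from hh)
  simp only [Prod.fst_add, Prod.snd_add, map_add, _root_.add_apply] at h1
  rw [map_neg, _root_.neg_apply, energyInner_comm Ω μ p.2]
  linarith

/-! ### Elements of the domain and skew-adjointness -/

lemma mem_bbA_of_H1 (w : H1) :
    ((Y.mk 0 (H1.val w) 0 0, Y.mk w (-U • H1.d 0 w) 0 (restr Ω (trace w))) : Y Ω × Y Ω)
      ∈ bbA Ω U hμ := by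
  refine ⟨?_, fun w' => ?_, ?_, fun w' => ?_⟩
  · simp
  · simp [real_inner_smul_left, H1.inner_d_zero]
  · simp
  · simp [psiTrace_apply]

lemma mem_bbA_of_plate {u : H02 Ω} {g : L2On Ω}
    (h : ∀ w, ⟪H02.lap Ω u, H02.lap Ω w⟫ = ⟪g, H02.val Ω w⟫) :
    ((Y.mk 0 0 u 0, Y.mk 0 0 0 (-g)) : Y Ω × Y Ω) ∈ bbA Ω U hμ := by
  refine ⟨?_, fun w' => ?_, ?_, fun w' => ?_⟩
  · simp
  · simp
  · simp
  · simp [psiTrace_apply, h]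

lemma mem_bbA_of_flow {φ κ : H1} (hκ : HasDerivAt (fun t => H1.shift t φ) κ 0) {f : L2Half}
    {v : H02 Ω}
    (h : ∀ w, opA μ (φ + neumannMap hμ (zeroExt Ω (H02.val Ω v))) w = ⟪f, H1.val w⟫) :
    ((Y.mk φ 0 0 (H02.val Ω v), Y.mk (-U • κ) (-f) v 0) : Y Ω × Y Ω) ∈ bbA Ω U hμ := by
  refine ⟨?_, fun w' => ?_, ?_, fun w' => ?_⟩
  · simp [d_zero_eq_of_hasDerivAt hκ]
  · simp only [Y.psi_mk, Y.phi_mk, Y.v_mk, h]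
    simp
  · simp
  · simp [psiTrace_apply, real_inner_smul_left, inner_restr_trace_of_hasDerivAt hκ]

lemma hasDerivAt_shift_solve_val (hμ : 0 < μ) (g : H1) :
    HasDerivAt (fun t => H1.shift t (solve (isCoercive_opA hμ) H1.val (H1.val g)))
      (solve (isCoercive_opA hμ) H1.val (H1.d 0 g)) 0 :=
  hasDerivAt_shift_solve hμ (τ := translHalf) shiftInvariant_halfSpace.inner_transl H1.val_shift
    g.hasDerivAt_transl

lemma hasDerivAt_shift_neumannMap (hμ : 0 < μ) (v : H02 Ω) :
    HasDerivAt (fun t => H1.shift t (neumannMap hμ (zeroExt Ω (-H02.val Ω v))))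
      (neumannMap hμ (zeroExt Ω (-H02.d Ω 0 v))) 0 := by
  have h := (-v).hasDerivAt_transl
  rw [map_neg, map_neg (H02.d Ω 0)] at h
  exact hasDerivAt_shift_solve hμ (τ := translPlane) shiftInvariant_plane.inner_transl trace_shift h

lemma H02.isCoercive_lap (hΩb : Bornology.IsBounded Ω) :
    IsCoercive ((ip (L2On Ω)).bilinearComp (H02.lap Ω) (H02.lap Ω)) := by
  obtain ⟨C, hC, h⟩ := H02.exists_norm_sq_le hΩb
  refine ⟨C⁻¹, inv_pos.2 hC, fun u => ?_⟩
  rw [mul_assoc, ← sq, inv_mul_le_iff₀ hC]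
  change _ ≤ C * ⟪H02.lap Ω u, H02.lap Ω u⟫
  rw [real_inner_self_eq_norm_sq]
  exact h u

section Adjoint

variable {y z : Y Ω}

/-- The first equation of the adjoint operator, from the elements of the domain with
`φ' = A⁻¹ g`, `g ∈ H¹`. -/
lemma phi_eq_of_adjoint
    (H : ∀ h ∈ bbA Ω U hμ, energyInner Ω μ y h.2 = energyInner Ω μ (-z) h.1) :
    H1.val (Y.phi z) = -U • H1.d 0 (Y.phi y) + Y.psi y := by
  symm
  rw [← sub_eq_zero]
  refine eq_zero_of_inner_val_H1 fun g => ?_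
  have h1 := H _ (mem_bbA_of_flow (v := (0 : H02 Ω)) (hasDerivAt_shift_solve_val hμ g)
    (f := H1.val g) fun w => by simp [form_solve])
  rw [energyInner_apply, energyInner_apply] at h1
  simp only [Y.phi_mk, Y.psi_mk, Y.u_mk, Y.v_mk, map_zero, map_neg, map_smul,
    inner_zero_right, inner_neg_right, _root_.neg_apply, smul_eq_mul] at h1
  rw [opA_comm, form_solve, opA_comm, form_solve] at h1
  have h2 := H1.inner_d_zero g (Y.phi y)
  have c1 := real_inner_comm (H1.val g) (Y.psi y)
  have c2 := real_inner_comm (H1.val g) (H1.d 0 (Y.phi y))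
  have c3 := real_inner_comm (H1.val g) (H1.val (Y.phi z))
  rw [inner_sub_left, inner_add_left, real_inner_smul_left]
  linear_combination -h1 - U * h2 - U * c2 - c3

/-- The second equation of the adjoint operator, from the elements of the domain with
`ψ' = w ∈ H¹` as the only nonzero component. -/
lemma psi_eq_of_adjoint
    (H : ∀ h ∈ bbA Ω U hμ, energyInner Ω μ y h.2 = energyInner Ω μ (-z) h.1)
    (w : H1) : ⟪Y.psi z, H1.val w⟫ = U * ⟪Y.psi y, H1.d 0 w⟫
      - opA μ (Y.phi y + neumannMap hμ (zeroExt Ω (Y.v y))) w := by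
  have h1 := H _ (mem_bbA_of_H1 w)
  rw [energyInner_apply, energyInner_apply] at h1
  simp only [Y.phi_mk, Y.psi_mk, Y.u_mk, Y.v_mk, map_zero, map_neg,
    inner_zero_right, inner_neg_left, real_inner_smul_right] at h1
  rw [map_add, _root_.add_apply, opA_neumannMap, inner_zeroExt]
  linear_combination h1

/-- The third equation of the adjoint operator, from the elements of the domain with
`u' = (Δ²)⁻¹ g` as the only nonzero component. -/
lemma u_eq_of_adjoint (hΩb : Bornology.IsBounded Ω)
    (H : ∀ h ∈ bbA Ω U hμ, energyInner Ω μ y h.2 = energyInner Ω μ (-z) h.1) :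
    H02.val Ω (Y.u z) = Y.v y := by
  refine ext_inner_left ℝ fun g => ?_
  have hs := form_solve (H02.isCoercive_lap hΩb) (H02.val Ω) g
  have h1 := H _ (mem_bbA_of_plate hs)
  rw [energyInner_apply, energyInner_apply] at h1
  simp only [Y.phi_mk, Y.psi_mk, Y.u_mk, Y.v_mk, map_zero, map_neg,
    inner_zero_right, inner_neg_left, inner_neg_right] at h1
  have h2 := hs (Y.u z)
  change ⟪H02.lap Ω _, H02.lap Ω (Y.u z)⟫ = _ at h2
  have c1 := real_inner_comm (H02.lap Ω (Y.u z))
    (H02.lap Ω (solve (H02.isCoercive_lap hΩb) (H02.val Ω) g))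
  have c2 := real_inner_comm g (Y.v y)
  linarith

/-- The fourth equation of the adjoint operator, from the elements of the domain with `v' = w`
and `φ' = -N v'`. -/
lemma v_eq_of_adjoint
    (H : ∀ h ∈ bbA Ω U hμ, energyInner Ω μ y h.2 = energyInner Ω μ (-z) h.1)
    (w : H02 Ω) : ⟪Y.v z, H02.val Ω w⟫ = -⟪H02.lap Ω (Y.u y), H02.lap Ω w⟫
      + psiTrace Ω U (Y.phi y, Y.phi z) (H02.val Ω w, H02.d Ω 0 w) := by
  have h1 := H _ (mem_bbA_of_flow (f := 0) (v := w) (hasDerivAt_shift_neumannMap hμ w)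
    fun w => by simp)
  rw [energyInner_apply, energyInner_apply] at h1
  simp only [Y.phi_mk, Y.psi_mk, Y.u_mk, Y.v_mk, map_zero, map_neg, map_smul,
    inner_zero_right, inner_neg_left, _root_.neg_apply, smul_eq_mul, neg_zero] at h1
  rw [opA_comm, opA_neumannMap, opA_comm, opA_neumannMap, inner_zeroExt, inner_zeroExt] at h1
  have c1 := real_inner_comm (H02.val Ω w) (restr Ω (trace (Y.phi z)))
  have c2 := real_inner_comm (H02.d Ω 0 w) (restr Ω (trace (Y.phi y)))
  rw [psiTrace_apply]
  linear_combination h1 - c1 + U * c2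

end Adjoint

/-- The operator `𝔸` is skew-adjoint. -/
theorem skewAdjointGraph_bbA (hΩb : Bornology.IsBounded Ω) :
    SkewAdjointGraph (energyInner Ω μ) (bbA Ω U hμ) := by
  intro y z
  constructor
  · intro hp h hh
    exact energyInner_skew (p := (y, z)) hp hh
  · intro H
    have h1 := phi_eq_of_adjoint H
    have h2 := psi_eq_of_adjoint H
    have h3 := u_eq_of_adjoint hΩb H
    have h4 := v_eq_of_adjoint H
    exact (⟨h1, h2, h3, h4⟩ : IsValue Ω U hμ y z)

/-- The operator `𝔸` is single-valued. -/
lemma eq_zero_of_mem_bbA (hΩ : IsOpen Ω) {z : Y Ω} (h : (0, z) ∈ bbA Ω U hμ) : z = 0 := by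
  obtain ⟨h1, h2, h3, h4⟩ := h
  simp only [map_zero, smul_zero, add_zero, inner_zero_left, mul_zero, _root_.zero_apply,
    sub_zero] at h1 h2 h3 h4
  have e1 : Y.phi z = 0 := H1.eq_of_val_eq (by rw [h1, map_zero])
  refine Y.ext e1 (eq_zero_of_inner_val_H1 h2) (H02.eq_zero_of_val_eq_zero hΩ h3)
    (eq_zero_of_inner_val_H02 hΩ fun w => ?_)
  rw [h4, e1, psiTrace_apply]
  simp

lemma injective_embed (hΩ : IsOpen Ω) (hΩb : Bornology.IsBounded Ω) :
    Function.Injective (embed Ω U hμ) := by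
  refine (injective_iff_map_eq_zero _).2 fun y hy => ?_
  have hc := isCoercive_energyInner hΩb hμ
  have hd := (skewAdjointGraph_bbA (U := U) (hμ := hμ) hΩb).dense_domain
    (energyInner_comm Ω μ) hc fun z hz => eq_zero_of_mem_bbA hΩ hz
  have h1 : energyInner Ω μ y = 0 := by
    refine ContinuousLinearMap.ext fun x => ?_
    refine congrFun (Continuous.ext_on hd (energyInner Ω μ y).continuous continuous_const ?_) x
    rintro x ⟨z, hz⟩
    exact congrArg (fun F : DualD Ω U hμ => F ⟨(x, z), hz⟩) hy
  exact hc.eq_zero_of_apply_self (by rw [h1]; rfl)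

end Plate

end FlowPlate

theorem proposition3p5 (U μ : ℝ) (hU : 0 ≤ U) (hU1 : U ≠ 1) (hμ : 0 < μ)
    (Ω : Set Plane) (hΩ : IsOpen Ω) (hΩb : Bornology.IsBounded Ω) :
    -- `𝔸` is skew-adjoint and generates a group, and `Y` embeds into `[D(𝔸)]'`
    IsSkewAdjoint Ω U hμ ∧
    Function.Injective (embed Ω U hμ) ∧
    (∃ S : C0Group (Y Ω), S.HasGenerator (bbA Ω U hμ)) ∧
    ∀ (S : C0Group (Y Ω)) (hS : S.HasGenerator (bbA Ω U hμ)) (T : ℝ), 0 < T →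
      ∀ (ubar : ℝ → H02 Ω), ContDiffOn ℝ 1 ubar (Icc 0 T) → ∀ y₀ : Y Ω,
        -- the integrals in the variation of parameters formula exist in `[D(𝔸)]'`
        (∀ t ∈ Icc 0 T, IntervalIntegrable
          (fun s => extGroup hS (t - s) (Psharp Ω U hμ (ubar s))) volume 0 t) ∧
        ∃ y : ℝ → Y Ω,
          -- the formula holds, and its values lie in `Y`
          (∀ t ∈ Icc 0 T, embed Ω U hμ (y t) = embed Ω U hμ (S.op t y₀)
            + ∫ s in (0 : ℝ)..t, extGroup hS (t - s) (Psharp Ω U hμ (ubar s))) ∧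
          ContinuousOn y (Icc 0 T) ∧
          ContDiffOn ℝ 1 (fun t => embed Ω U hμ (y t)) (Ioo 0 T) ∧
          (∀ t ∈ Ioo 0 T, HasDerivAt (fun t => embed Ω U hμ (y t))
            (extA Ω U hμ (y t) + Psharp Ω U hμ (ubar t)) t) ∧
          y 0 = y₀ := by
  have hB : SkewAdjointGraph (energyInner Ω μ) (bbA Ω U hμ) := skewAdjointGraph_bbA hΩb
  have hc : IsCoercive (energyInner Ω μ) := isCoercive_energyInner hΩb hμ
  exact ⟨hB, injective_embed hΩ hΩb, hB.exists_group_of_coercive (energyInner_comm Ω μ) hc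
    fun z hz => eq_zero_of_mem_bbA hΩ hz, fun S hS T hT ubar hu y₀ =>
    exists_mild_solution hS hB hc hT hu y₀⟩
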